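/- Let $p$ be a prime and let $R$ be an $F$-finite regular domain of characteristic $p$ (that is, the Frobenius $u\mapsto u^p$ makes $R$ a finite module over itself), and let $f\in R$ be nonzero. *Test ideals.* For an ideal $J\subseteq R$ let $J^{[p^e]}=(u^{p^e}\mid u\in J)$, and let $\mathfrak b^{[1/p^e]}$ be the smallest ideal $J$ with $\mathfrak b\subseteq J^{[p^e]}$. For a real number $\lambda\ge 0$ let $\tau(f^\lambda)$ be the stable value of the ascending chain of ideals $(f^{\lceil\lambda p^e\rceil})^{[1/p^e]}$, $e\gg 0$. A real number $\lambda>0$ is an $F$-jumping exponent of $f$ if $\tau(f^\lambda)\ne\tau(f^{\lambda-\varepsilon})$ for every $0<\varepsilon\le\lambda$. *Bernstein–Sato polynomials.* For $e\ge1$ put $D_R^e=\mathrm{End}_{R^{p^e}}(R)$ and $D_{R[t]}^e=\mathrm{End}_{R[t]^{p^e}}(R[t])$. The operators in $D_R^e$ act on $R[t]$ coefficientwise, so that $D_R^e\subseteq D_{R[t]}^e$; for $m<p^e$ let $\theta_m=\partial_t^{[m]}t^m\in D_{R[t]}^e$, where $\partial_t^{[m]}(at^r)=\binom rm at^{r-m}$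 for $a\in R$. Let $B_f=R[t]_{f-t}/R[t]$ with its natural $D_{R[t]}^e$-module structure (induced by $P\cdot\frac{h}{(f-t)^{kp^e}}=\frac{P(h)}{(f-t)^{kp^e}}$), let $\delta\in B_f$ be the class of $\frac1{f-t}$, and let $$M_f^e=D_R^e[\theta_1,\theta_p,\ldots,\theta_{p^{e-1}}]\cdot\delta\subseteq B_f .$$ The ring $D_R^e[\theta_1,\theta_p,\ldots,\theta_{p^{e-1}}]$ acts on $M_f^e/tM_f^e$. Let $\Gamma_f^e$ be the set of tuples $(i_1,\ldots,i_e)\in\{0,\ldots,p-1\}^e$ for which there is a nonzero $w\in M_f^e/tM_f^e$ with $(\theta_{p^{\ell-1}}+i_\ell)w=0$ for all $1\le\ell\le e$, and put $$b_f^{(e)}(s)=\prod_{(i_1,\ldots,i_e)\in\Gamma_f^e}\left(s-\left(\frac{i_e}{p}+\cdots+\frac{i_1}{p^e}\right)\right)\in\mathbf Q[s].$$ **Theorem.** For every $e\ge1$, the roots of $b_f^{(e)}$ are simple, and the set of these roots is exactly the set of rational numbers $\frac{\lceil p^e\lambda\rceil-1}{p^e}$, where $\lambda$ runs over the $F$-jumping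 exponents of $f$ in $(0,1]$. -/

import Mathlib

open Polynomial

namespace BernsteinSato

section DiffOps

variable (A : Type*) [CommRing A] (p : ℕ) [ExpChar A p] (e : ℕ)

/-- The subring `A^{p^e}` of `p^e`-th powers of a ring `A` of characteristic `p`. -/
abbrev powSubring : Subring A := (iterateFrobenius A p e).range

/-- The ring `D_A^e = End_{A^{p^e}}(A)` of differential operators of level `e`. -/
abbrev DiffOp : Type _ := Module.End (powSubring A p e) A

end DiffOps

section LocAction

variable {A : Type*} [CommRing A] (p : ℕ) [ExpChar A p] (e : ℕ)

lemma DiffOp.map_pow_mul (P : DiffOp A p e) (a x : A) :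
    P (a ^ p ^ e * x) = a ^ p ^ e * P x :=
  P.map_smul ⟨a ^ p ^ e, a, rfl⟩ x

/-- Constructor: an additive endomorphism commuting with multiplication by `p^e`-th powers. -/
def DiffOp.mk' (P : A →+ A) (h : ∀ a x : A, P (a ^ p ^ e * x) = a ^ p ^ e * P x) :
    DiffOp A p e where
  toFun := P
  map_add' := P.map_add
  map_smul' := by
    rintro ⟨_, a, rfl⟩ x
    exact h a x

lemma DiffOp.mk'_apply (P : A →+ A) (h : ∀ a x : A, P (a ^ p ^ e * x) = a ^ p ^ e * P x) (x : A) :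
    DiffOp.mk' p e P h x = P x := rfl

/-- Multiplication by `a ∈ A`, as an element of `D_A^e`. -/
def mulOp (a : A) : DiffOp A p e := LinearMap.mulLeft (powSubring A p e) a

lemma mulOp_apply (a x : A) : mulOp p e a x = a * x := rfl

variable (g : A)

/-- `g^{p^e}`, as an element of `A^{p^e}`. -/
def powElt : powSubring A p e := ⟨g ^ p ^ e, g, rfl⟩

/-- The localization map `A → A_g`, as a map of `A^{p^e}`-modules. -/
noncomputable abbrev locMap : A →ₗ[powSubring A p e] Localization.Away g :=
  (IsScalarTower.toAlgHom (powSubring A p e) A (Localization.Away g)).toLinearMap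

/-- `A_g` is the localization of the `A^{p^e}`-module `A` at the powers of `g^{p^e}`. -/
instance isLocalizedModule_locMap :
    IsLocalizedModule (Submonoid.powers (powElt p e g)) (locMap p e g) := by
  have hq : p ^ e ≠ 0 := (expChar_pow_pos A p e).ne'
  have key : ∀ n : ℕ, algebraMap A (Localization.Away g) (g ^ n) =
      algebraMap A (Localization.Away g) g ^ n := fun n => map_pow _ _ _
  refine ⟨?_, ?_, ?_⟩
  · rintro ⟨_, n, rfl⟩
    rw [Module.End.isUnit_iff]
    have hu : IsUnit (algebraMap A (Localization.Away g) ((g ^ p ^ e) ^ n)) := by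
      rw [← pow_mul, key]
      exact (IsLocalization.Away.algebraMap_isUnit g).pow _
    have hact : ∀ x : Localization.Away g,
        algebraMap (powSubring A p e) (Module.End (powSubring A p e) (Localization.Away g))
          (powElt p e g ^ n) x = algebraMap A (Localization.Away g) ((g ^ p ^ e) ^ n) * x := by
      intro x
      rw [Module.algebraMap_end_apply, Algebra.smul_def]
      rfl
    obtain ⟨u, hu⟩ := hu
    constructor
    · intro x y hxy
      simp only [hact, ← hu] at hxy
      exact (Units.mul_right_inj u).1 hxy
    · intro y
      refine ⟨↑u⁻¹ * y, ?_⟩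
      simp only [hact, ← hu, Units.mul_inv_cancel_left]
  · intro y
    obtain ⟨n, a, ha⟩ := IsLocalization.Away.surj g y
    refine ⟨(g ^ (p ^ e * n - n) * a, ⟨powElt p e g ^ n, n, rfl⟩), ?_⟩
    have hle : n ≤ p ^ e * n := Nat.le_mul_of_pos_left n (Nat.pos_of_ne_zero hq)
    have h1 : (⟨powElt p e g ^ n, n, rfl⟩ : Submonoid.powers (powElt p e g)) • y =
        algebraMap A (Localization.Away g) ((g ^ p ^ e) ^ n) * y := by
      rw [Submonoid.smul_def, Algebra.smul_def]
      rfl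
    have h2 : locMap p e g (g ^ (p ^ e * n - n) * a) =
        algebraMap A (Localization.Away g) (g ^ (p ^ e * n - n) * a) := rfl
    rw [h1, h2, map_mul, ← ha, ← pow_mul, key, key, mul_left_comm, mul_comm, ← pow_add,
      Nat.sub_add_cancel hle]
  · intro x y hxy
    obtain ⟨n, hn⟩ := IsLocalization.Away.exists_of_eq (S := Localization.Away g) g hxy
    refine ⟨⟨powElt p e g ^ n, n, rfl⟩, ?_⟩
    have hle : n ≤ p ^ e * n := Nat.le_mul_of_pos_left n (Nat.pos_of_ne_zero hq)
    change (g ^ p ^ e) ^ n * x = (g ^ p ^ e) ^ n * y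
    rw [← pow_mul, ← Nat.sub_add_cancel hle, pow_add, mul_assoc, mul_assoc, hn]

/-- The action of `D_A^e` on the localization `A_g`: the operator `P` acts by
`P (x / g^{k p^e}) = P x / g^{k p^e}`. -/
noncomputable def locAction :
    DiffOp A p e →+* Module.End (powSubring A p e) (Localization.Away g) where
  toFun := IsLocalizedModule.map (Submonoid.powers (powElt p e g)) (locMap p e g) (locMap p e g)
  map_one' := IsLocalizedModule.map_id _ _
  map_mul' P Q := IsLocalizedModule.map_comp' _ (locMap p e g) (locMap p e g) (locMap p e g) Q P
  map_zero' := map_zero _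
  map_add' := map_add _

lemma locAction_algebraMap (P : DiffOp A p e) (x : A) :
    locAction p e g P (algebraMap A (Localization.Away g) x) =
      algebraMap A (Localization.Away g) (P x) :=
  IsLocalizedModule.map_apply _ (locMap p e g) (locMap p e g) P x

lemma locAction_mulOp (a : A) (x : Localization.Away g) :
    locAction p e g (mulOp p e a) x = a • x := by
  have : locAction p e g (mulOp p e a) =
      (LinearMap.mulLeft (powSubring A p e) (algebraMap A (Localization.Away g) a)) := by
    apply IsLocalizedModule.linearMap_ext (Submonoid.powers (powElt p e g)) (locMap p e g)
      (locMap p e g)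
    ext x
    change locAction p e g (mulOp p e a) (algebraMap A (Localization.Away g) x) =
      algebraMap A (Localization.Away g) a * algebraMap A (Localization.Away g) x
    rw [locAction_algebraMap, ← map_mul]
    rfl
  rw [this, LinearMap.mulLeft_apply, Algebra.smul_def]

/-- The local cohomology module `A_g / A`. -/
abbrev LocQuot : Type _ :=
  Localization.Away g ⧸ LinearMap.range (Algebra.linearMap A (Localization.Away g))

/-- The action of `D_A^e` on `A_g / A` induced by the action on `A_g`. -/
noncomputable def locQuotAction : DiffOp A p e →+* AddMonoid.End (LocQuot g) where
  toFun P := QuotientAddGroup.map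
    (LinearMap.range (Algebra.linearMap A (Localization.Away g))).toAddSubgroup
    (LinearMap.range (Algebra.linearMap A (Localization.Away g))).toAddSubgroup
    (locAction p e g P).toAddMonoidHom (by
      rintro _ ⟨x, rfl⟩
      exact ⟨P x, (locAction_algebraMap p e g P x).symm⟩)
  map_one' := by
    ext x
    obtain ⟨x, rfl⟩ := Submodule.Quotient.mk_surjective _ x
    exact congrArg (Submodule.Quotient.mk) (by rw [map_one]; rfl)
  map_mul' P Q := by
    ext x
    obtain ⟨x, rfl⟩ := Submodule.Quotient.mk_surjective _ x
    exact congrArg (Submodule.Quotient.mk) (by rw [map_mul]; rfl)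
  map_zero' := by
    ext x
    obtain ⟨x, rfl⟩ := Submodule.Quotient.mk_surjective _ x
    exact congrArg (Submodule.Quotient.mk) (by rw [map_zero]; rfl)
  map_add' P Q := by
    ext x
    obtain ⟨x, rfl⟩ := Submodule.Quotient.mk_surjective _ x
    exact congrArg (Submodule.Quotient.mk) (by rw [map_add]; rfl)

end LocAction

section Polynomial

lemma coeff_monomial_pow_mul {R : Type*} [CommRing R] (p e i : ℕ) (a : R) (h : R[X]) (n : ℕ) :
    ((monomial i a) ^ p ^ e * h).coeff n =
      if i * p ^ e ≤ n then a ^ p ^ e * h.coeff (n - i * p ^ e) else 0 := by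
  rw [monomial_pow, ← C_mul_X_pow_eq_monomial, mul_assoc, coeff_C_mul, coeff_X_pow_mul']
  split_ifs <;> simp

variable {R : Type*} [CommRing R] (p : ℕ) [Fact p.Prime] [CharP R p] (e : ℕ)

/-- Commutation with `p^e`-th powers of polynomials can be tested on monomials. -/
lemma pow_mul_of_monomial (P : R[X] →+ R[X])
    (H : ∀ (i : ℕ) (a : R) (h : R[X]),
      P ((monomial i a) ^ p ^ e * h) = (monomial i a) ^ p ^ e * P h) (g h : R[X]) :
    P (g ^ p ^ e * h) = g ^ p ^ e * P h := by
  induction g using Polynomial.induction_on' with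
  | add f g hf hg => rw [add_pow_expChar_pow, add_mul, map_add, hf, hg, add_mul]
  | monomial i a => exact H i a h

/-- The coefficientwise extension of an additive map. -/
noncomputable def coeffwise (P : R →+ R) : R[X] →+ R[X] where
  toFun h := h.sum fun n a => monomial n (P a)
  map_zero' := by simp
  map_add' f g := by
    rw [Polynomial.sum_add_index] <;> simp

lemma coeffwise_coeff (P : R →+ R) (h : R[X]) (n : ℕ) :
    (coeffwise P h).coeff n = P (h.coeff n) := by
  change (h.sum fun n a => monomial n (P a)).coeff n = _
  rw [Polynomial.sum_def, finsetSum_coeff]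
  simp only [coeff_monomial]
  rw [Finset.sum_ite_eq']
  split_ifs with hn
  · rfl
  · rw [notMem_support_iff.1 hn, map_zero]

/-- The inclusion `D_R^e ⊆ D_{R[t]}^e`: an operator on `R` acts on `R[t]` coefficientwise. -/
noncomputable def constOp (P : DiffOp R p e) : DiffOp R[X] p e :=
  DiffOp.mk' p e (coeffwise P.toAddMonoidHom) <| pow_mul_of_monomial p e _ fun i a h => by
    ext n
    simp only [coeffwise_coeff, coeff_monomial_pow_mul]
    split_ifs
    · exact DiffOp.map_pow_mul p e P a _
    · exact map_zero _

lemma choose_add_mul_pow (m : ℕ) (hm : m < p ^ e) (i j : ℕ) :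
    ((i * p ^ e + j).choose m : R) = (j.choose m : R) := by
  have key : ∀ k : ℕ, ((X + 1 : R[X]) ^ k).coeff m = (k.choose m : R) := fun k =>
    coeff_X_add_one_pow R k m
  rw [← key, ← key, pow_add, mul_comm i, pow_mul, add_pow_expChar_pow, one_pow]
  have : ((X : R[X]) ^ p ^ e + 1) ^ i = 1 + X ^ p ^ e *
      (∑ k ∈ Finset.range i, ((X : R[X]) ^ p ^ e + 1) ^ k) := by
    have := geom_sum_mul ((X : R[X]) ^ p ^ e + 1) i
    rw [add_sub_cancel_right] at this
    rw [mul_comm, this]; ring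
  rw [this, add_mul, one_mul, coeff_add, mul_assoc, coeff_X_pow_mul', if_neg (by omega), add_zero]

/-- The divided power operator `∂_t^{[m]}`, for `m < p^e`, as an element of `D_{R[t]}^e`;
it sends `a t^r` to `a (r choose m) t^{r-m}`. -/
noncomputable def dividedPowerOp (m : ℕ) (hm : m < p ^ e) : DiffOp R[X] p e :=
  DiffOp.mk' p e (hasseDeriv m : R[X] →ₗ[R] R[X]).toAddMonoidHom <|
    pow_mul_of_monomial p e _ fun i a h => by
      ext n
      change (hasseDeriv m _).coeff n = ((monomial i a) ^ p ^ e * hasseDeriv m h).coeff n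
      rw [coeff_monomial_pow_mul, hasseDeriv_coeff, coeff_monomial_pow_mul, hasseDeriv_coeff]
      by_cases h1 : i * p ^ e ≤ n
      · obtain ⟨k, rfl⟩ := Nat.exists_eq_add_of_le h1
        rw [if_pos h1, if_pos (by omega), add_assoc, choose_add_mul_pow p e m hm,
          Nat.add_sub_cancel_left, Nat.add_sub_cancel_left]
        ring
      · rw [if_neg h1]
        by_cases h2 : i * p ^ e ≤ n + m
        · rw [if_pos h2]
          have h3 : n + m = i * p ^ e + (n + m - i * p ^ e) := by omega
          have h4 : (((n + m).choose m : ℕ) : R) = 0 := by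
            rw [h3, choose_add_mul_pow p e m hm, Nat.choose_eq_zero_of_lt (by omega),
              Nat.cast_zero]
          rw [h4, zero_mul]
        · rw [if_neg h2, mul_zero]

lemma dividedPowerOp_apply (m : ℕ) (hm : m < p ^ e) (h : R[X]) :
    dividedPowerOp p e m hm h = hasseDeriv m h := rfl

/-- The operator `θ_m = ∂_t^{[m]} t^m` for `m < p^e`. -/
noncomputable def eulerOp (m : ℕ) (hm : m < p ^ e) : DiffOp R[X] p e :=
  dividedPowerOp p e m hm * mulOp p e (X ^ m)

variable (R) in
/-- The operator `θ_{p^i}` for `0 ≤ i < e`. -/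
noncomputable def theta (i : Fin e) : DiffOp R[X] p e :=
  eulerOp p e (p ^ (i : ℕ)) (Nat.pow_lt_pow_right (Fact.out : p.Prime).one_lt i.2)

variable (R) in
/-- The subring `D_R^e[θ_1, θ_p, …, θ_{p^{e-1}}]` of `D_{R[t]}^e`. -/
noncomputable def eulerSubring : Subring (DiffOp R[X] p e) :=
  Subring.closure (Set.range (constOp (R := R) p e) ∪ Set.range (theta R p e))

lemma theta_mem (i : Fin e) : theta R p e i ∈ eulerSubring R p e :=
  Subring.subset_closure (Or.inr ⟨i, rfl⟩)


lemma constOp_coeff (P : DiffOp R p e) (h : R[X]) (n : ℕ) :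
    (constOp p e P h).coeff n = P (h.coeff n) := coeffwise_coeff _ _ _

lemma eulerOp_coeff (m : ℕ) (hm : m < p ^ e) (h : R[X]) (n : ℕ) :
    (eulerOp p e m hm h).coeff n = ((n + m).choose m : R) * h.coeff n := by
  rw [eulerOp, Module.End.mul_apply, mulOp_apply, dividedPowerOp_apply, hasseDeriv_coeff, coeff_X_pow_mul]

variable (R) in
/-- By Lucas' theorem, `(n choose p^l) = ⌊n / p^l⌋` in characteristic `p`. -/
lemma choose_pow_eq_div (l n : ℕ) : ((n.choose (p ^ l) : ℕ) : R) = ((n / p ^ l : ℕ) : R) := by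
  induction l generalizing n with
  | zero => simp
  | succ l ih =>
    have h := (CharP.cast_eq_iff_mod_eq R p).2
      (Choose.choose_modEq_choose_mod_mul_choose_div_nat (n := n) (k := p ^ (l + 1)) (p := p))
    have hp : 0 < p := (Fact.out : p.Prime).pos
    rw [h, pow_succ, Nat.mul_mod_left, Nat.choose_zero_right, one_mul, Nat.mul_div_cancel _ hp, ih,
      Nat.div_div_eq_div_mul, mul_comm p]

lemma theta_coeff (i : Fin e) (h : R[X]) (n : ℕ) :
    (theta R p e i h).coeff n = ((n / p ^ (i : ℕ) + 1 : ℕ) : R) * h.coeff n := by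
  have hp : 0 < p := (Fact.out : p.Prime).pos
  rw [theta, eulerOp_coeff, choose_pow_eq_div, Nat.add_div_right _ (pow_pos hp _)]

lemma theta_pow_coeff (i : Fin e) (k : ℕ) (h : R[X]) (n : ℕ) :
    ((theta R p e i ^ k) h).coeff n = ((n / p ^ (i : ℕ) + 1 : ℕ) : R) ^ k * h.coeff n := by
  induction k generalizing h with
  | zero => simp
  | succ k ih => rw [pow_succ, Module.End.mul_apply, ih, theta_coeff, pow_succ, mul_assoc]

variable (R) in
lemma natCast_pow_sub_one (m : ℕ) : (m : R) ^ (p - 1) = if p ∣ m then 0 else 1 := by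
  have hp := (Fact.out : p.Prime)
  split_ifs with h
  · rw [(CharP.cast_eq_zero_iff R p m).2 h, zero_pow (Nat.sub_ne_zero_of_lt hp.one_lt)]
  · have h0 : (m : ZMod p) ≠ 0 := fun h' => h ((ZMod.natCast_eq_zero_iff m p).1 h')
    have := congrArg (ZMod.castHom (dvd_refl p) R) (ZMod.pow_card_sub_one_eq_one h0)
    rwa [map_pow, map_natCast, map_one] at this

/-- The projection onto the span of the `t^n` with `p^i ∣ n + 1` is a polynomial in the `θ`'s. -/
lemma exists_projection (i : ℕ) (hi : i ≤ e) : ∃ E ∈ eulerSubring R p e, ∀ (h : R[X]) (n : ℕ),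
    (E h).coeff n = if p ^ i ∣ n + 1 then h.coeff n else 0 := by
  have hp := (Fact.out : p.Prime)
  induction i with
  | zero => exact ⟨1, one_mem _, fun h n => by simp⟩
  | succ i ih =>
    obtain ⟨E, hE, hc⟩ := ih (by omega)
    refine ⟨E * (1 - theta R p e ⟨i, hi⟩ ^ (p - 1)),
      mul_mem hE (sub_mem (one_mem _) (pow_mem (theta_mem p e _) _)), fun h n => ?_⟩
    rw [Module.End.mul_apply, hc, LinearMap.sub_apply, Module.End.one_apply, coeff_sub,
      theta_pow_coeff, natCast_pow_sub_one]
    by_cases h1 : p ^ i ∣ n + 1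
    · have h2 : n / p ^ i + 1 = (n + 1) / p ^ i := by rw [Nat.succ_div, if_pos h1]
      have h3 : p ^ (i + 1) ∣ n + 1 ↔ p ∣ n / p ^ i + 1 := by
        rw [h2, Nat.dvd_div_iff_mul_dvd h1, pow_succ]
      rw [if_pos h1]
      by_cases h4 : p ^ (i + 1) ∣ n + 1
      · rw [if_pos h4, if_pos (h3.1 h4)]; ring
      · rw [if_neg h4, if_neg (fun h => h4 (h3.2 h))]; ring
    · rw [if_neg h1, if_neg (fun h => h1 ((pow_dvd_pow p (Nat.le_succ i)).trans h))]

/-- `S t ⊆ t S` for `S = D_R^e[θ_1, θ_p, …, θ_{p^{e-1}}]`. -/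
lemma exists_mul_mulOp_X (s : DiffOp R[X] p e) (hs : s ∈ eulerSubring R p e) :
    ∃ s' ∈ eulerSubring R p e, s * mulOp p e X = mulOp p e X * s' := by
  induction hs using Subring.closure_induction with
  | mem s hs =>
    rcases hs with ⟨P, rfl⟩ | ⟨i, rfl⟩
    · refine ⟨_, Subring.subset_closure (Or.inl ⟨P, rfl⟩), ?_⟩
      refine LinearMap.ext fun h => ?_
      rw [Module.End.mul_apply, Module.End.mul_apply, mulOp_apply, mulOp_apply]
      ext n
      cases n with
      | zero => rw [constOp_coeff, coeff_X_mul_zero, coeff_X_mul_zero, map_zero]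
      | succ n => rw [constOp_coeff, coeff_X_mul, coeff_X_mul, constOp_coeff]
    · obtain ⟨E, hE, hc⟩ := exists_projection (R := R) p e i i.2.le
      refine ⟨theta R p e i + E, add_mem (theta_mem p e i) hE, ?_⟩
      refine LinearMap.ext fun h => ?_
      rw [Module.End.mul_apply, Module.End.mul_apply, mulOp_apply, mulOp_apply,
        LinearMap.add_apply]
      ext n
      cases n with
      | zero => rw [theta_coeff, coeff_X_mul_zero, coeff_X_mul_zero, mul_zero]
      | succ n =>
        rw [theta_coeff, coeff_X_mul, coeff_X_mul, coeff_add, theta_coeff, hc, Nat.succ_div]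
        split_ifs <;> push_cast <;> ring
  | zero => exact ⟨0, zero_mem _, by rw [zero_mul, mul_zero]⟩
  | one => exact ⟨1, one_mem _, by rw [one_mul, mul_one]⟩
  | add a b _ _ ha hb =>
    obtain ⟨a', ha', h1⟩ := ha
    obtain ⟨b', hb', h2⟩ := hb
    exact ⟨a' + b', add_mem ha' hb', by rw [add_mul, h1, h2, mul_add]⟩
  | neg a _ ha =>
    obtain ⟨a', ha', h1⟩ := ha
    exact ⟨-a', neg_mem ha', (neg_mul a _).trans ((congrArg Neg.neg h1).trans (mul_neg _ a').symm)⟩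
  | mul a b _ _ ha hb =>
    obtain ⟨a', ha', h1⟩ := ha
    obtain ⟨b', hb', h2⟩ := hb
    exact ⟨a' * b', mul_mem ha' hb', by rw [mul_assoc, h2, ← mul_assoc, h1, mul_assoc]⟩

end Polynomial

section BernsteinSatoPolynomial

variable {R : Type*} [CommRing R] (p : ℕ) [Fact p.Prime] [CharP R p] (e : ℕ) (f : R)

/-- The module `B_f = R[t]_{f-t} / R[t]`. -/
def B : Type _ := LocQuot (C f - X : R[X])

noncomputable instance : AddCommGroup (B f) :=
  inferInstanceAs (AddCommGroup (LocQuot (C f - X : R[X])))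

noncomputable instance : Module R[X] (B f) :=
  inferInstanceAs (Module R[X] (LocQuot (C f - X : R[X])))

/-- The `D_{R[t]}^e`-module structure on `B_f`. -/
noncomputable instance : Module (DiffOp R[X] p e) (B f) :=
  Module.compHom (LocQuot (C f - X : R[X])) (locQuotAction p e (C f - X : R[X]))

lemma mulOp_smul (a : R[X]) (u : B f) : mulOp p e a • u = a • u := by
  obtain ⟨x, rfl⟩ := Submodule.Quotient.mk_surjective _ u
  exact congrArg (Submodule.Quotient.mk) (locAction_mulOp p e (C f - X : R[X]) a x)

/-- The element `δ`, the class of `1 / (f - t)` in `B_f`. -/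
noncomputable def delta : B f :=
  Submodule.Quotient.mk (IsLocalization.Away.invSelf (C f - X : R[X]))

/-- `M_f^e = D_R^e[θ_1, θ_p, …, θ_{p^{e-1}}] · δ ⊆ B_f`. -/
noncomputable def M : Submodule (eulerSubring R p e) (B f) :=
  Submodule.span (eulerSubring R p e) {delta f}

/-- `t M_f^e ⊆ B_f`. -/
noncomputable def tM : Submodule (eulerSubring R p e) (B f) where
  carrier := {v | ∃ u ∈ M p e f, v = (X : R[X]) • u}
  zero_mem' := ⟨0, zero_mem _, (smul_zero _).symm⟩
  add_mem' := by
    rintro _ _ ⟨u, hu, rfl⟩ ⟨v, hv, rfl⟩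
    exact ⟨u + v, add_mem hu hv, (smul_add _ _ _).symm⟩
  smul_mem' := by
    rintro ⟨s, hs⟩ _ ⟨u, hu, rfl⟩
    obtain ⟨s', hs', h⟩ := exists_mul_mulOp_X p e s hs
    refine ⟨(⟨s', hs'⟩ : eulerSubring R p e) • u, Submodule.smul_mem _ _ hu, ?_⟩
    change s • (X : R[X]) • u = (X : R[X]) • s' • u
    rw [← mulOp_smul p e, ← mulOp_smul p e, smul_smul, smul_smul, h]

/-- The quotient `M_f^e / t M_f^e` (where `t M_f^e ⊆ M_f^e`), as a module over
`D_R^e[θ_1, θ_p, …, θ_{p^{e-1}}]`. -/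
abbrev MQuot : Type _ := M p e f ⧸ (tM p e f).submoduleOf (M p e f)

open Classical in
/-- The set `Γ_f^e` of the tuples `(i_1, …, i_e) ∈ {0, …, p-1}^e` for which there is a nonzero
`w ∈ M_f^e / t M_f^e` with `(θ_{p^{ℓ-1}} + i_ℓ) w = 0` for `1 ≤ ℓ ≤ e`. The entry `i_ℓ` is
`i (ℓ - 1)`, since `Fin e` starts at `0`. -/
noncomputable def GammaSet : Finset (Fin e → Fin p) :=
  Finset.univ.filter fun i => ∃ w : MQuot p e f, w ≠ 0 ∧
    ∀ l : Fin e,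
      ((⟨theta R p e l, theta_mem p e l⟩ : eulerSubring R p e) +
        ((i l : ℕ) : eulerSubring R p e)) • w = 0

/-- The higher Bernstein-Sato polynomial
`b_f^{(e)}(s) = ∏_{(i_1, …, i_e) ∈ Γ_f^e} (s - (i_e / p + ⋯ + i_1 / p^e))`. -/
noncomputable def bernsteinSato : ℚ[X] :=
  ∏ i ∈ GammaSet p e f, (X - C (∑ l : Fin e, ((i l : ℕ) : ℚ) / (p : ℚ) ^ (e - (l : ℕ))))

end BernsteinSatoPolynomial

section TestIdeals

variable {R : Type*} [CommRing R] (p : ℕ) [ExpChar R p]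

/-- The Frobenius power `J^{[p^e]}`, generated by the `p^e`-th powers of the elements of `J`. -/
def frobeniusPower (e : ℕ) (J : Ideal R) : Ideal R :=
  Ideal.span ((fun u => u ^ p ^ e) '' (J : Set R))

/-- The ideal `𝔟^{[1/p^e]}`: the smallest ideal `J` with `𝔟 ⊆ J^{[p^e]}`. -/
def frobeniusRoot (e : ℕ) (b : Ideal R) : Ideal R :=
  sInf {J : Ideal R | b ≤ frobeniusPower p e J}

/-- The test ideal `τ(f^λ)`: the eventual value of the ascending chain of ideals
`(f^{⌈λ p^e⌉})^{[1/p^e]}`, that is, their union. -/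
noncomputable def testIdeal (f : R) (lam : ℝ) : Ideal R :=
  ⨆ e : ℕ, frobeniusRoot p e (Ideal.span {f ^ ⌈lam * (p : ℝ) ^ e⌉₊})

/-- `λ ≥ 0` is an `F`-jumping exponent of `f` if `λ = 0` (by convention), or `λ > 0` and
`τ(f^λ) ≠ τ(f^{λ-ε})` for every `ε > 0` (with `λ - ε ≥ 0`). -/
def IsFJumpingExponent (f : R) (lam : ℝ) : Prop :=
  lam = 0 ∨ (0 < lam ∧ ∀ ε : ℝ, 0 < ε → ε ≤ lam → testIdeal p f lam ≠ testIdeal p f (lam - ε))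

end TestIdeals

end BernsteinSato

/-!
Write `q = p^e`. By Kunz's theorem the regular `F`-finite ring `R` is a finite projective module
over itself via the `e`-th Frobenius (`projective_frobeniusAlgebra`): in a regular local ring the
`q`-th powers of a regular system of parameters form a regular sequence, and a finite module on
which a regular system of parameters is a regular sequence is free. A dual basis of this module
(`FrobeniusDualBasis`) makes the Frobenius roots explicit, and it gives
`D_R^e · g = ((g)^{[1/q]})^{[q]}`. So `D_R^e f^j ≠ D_R^e f^{j+1}` if and only if
`(f^j)^{[1/q]} ≠ (f^{j+1})^{[1/q]}`.

In `B_f` the class `δ` is `(f - t)^{q-1} / (f - t)^q`, where `(f - t)^{q-1} = ∑ f^{q-1-n} t^n` and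
`(f - t)^q = f^q - t^q`. The operators `θ_{p^l}` act on `t^n` by scalars that determine the digits
of `n`, for `n < q`, so that `M_f^e` is the direct sum of the `D_R^e f^{q-1-n} · t^n`. Since
`t^q = f^q` modulo `(f - t)^q`, the component of `M_f^e / t M_f^e` in degree `n = q - 1 - j` is
`D_R^e f^j / D_R^e f^{j+1}`, and there `θ_{p^{l-1}}` acts as minus the `l`-th digit of `j`. Hence
`Γ_f^e` corresponds to the numbers `j < q` with `(f^j)^{[1/q]} ≠ (f^{j+1})^{[1/q]}`
(`mem_GammaSet_iff`), and the root attached to such a `j` is `j / q`.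

Finally `(f^j)^{[1/q]} = τ(f^{j/q})` (`testIdeal_div`), and the test ideals are decreasing and
right-continuous in the exponent (`exists_pos_testIdeal_add_eq`). So `τ(f^{j/q})` and
`τ(f^{(j+1)/q})` differ if and only if there is a jump `λ` in `(j/q, (j+1)/q]`
(`exists_isFJumpingExponent_iff`), that is, one with `⌈q λ⌉ - 1 = j`.
-/

namespace BernsteinSato

/-! ### Regular local rings and regular sequences -/

section RegularLocal

open IsLocalRing RingTheory.Sequence Pointwise

/-- An element of `𝔪 \ 𝔪²` can be exchanged for one of the given generators of `𝔪`. -/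
theorem exists_ofList_cons_eq {A : Type*} [CommRing A] [IsLocalRing A] (l : List A) (x : A)
    (hl : ∀ y ∈ l, y ∈ maximalIdeal A) (hx : x ∈ Ideal.ofList l) (hx2 : x ∉ maximalIdeal A ^ 2) :
    ∃ l' : List A, l'.length + 1 = l.length ∧ Ideal.ofList (x :: l') = Ideal.ofList l := by
  induction l generalizing x with
  | nil =>
    rw [Ideal.ofList_nil, Ideal.mem_bot] at hx
    exact absurd (hx ▸ zero_mem _) hx2
  | cons y l ih =>
    rw [Ideal.ofList_cons, Submodule.mem_sup] at hx
    obtain ⟨w, hw, z, hz, rfl⟩ := hx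
    obtain ⟨a, rfl⟩ := Ideal.mem_span_singleton'.1 hw
    by_cases ha : IsUnit a
    · refine ⟨l, rfl, ?_⟩
      rw [Ideal.ofList_cons, Ideal.ofList_cons]
      apply le_antisymm
      · refine sup_le ((Ideal.span_singleton_le_iff_mem _).2 ?_) le_sup_right
        exact add_mem (Submodule.mem_sup_left hw) (Submodule.mem_sup_right hz)
      · refine sup_le ((Ideal.span_singleton_le_iff_mem _).2 ?_) le_sup_right
        rw [← Ideal.unit_mul_mem_iff_mem _ ha]
        have := sub_mem (Submodule.mem_sup_left (T := Ideal.ofList l)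
          (Ideal.mem_span_singleton_self (a * y + z))) (Submodule.mem_sup_right hz)
        rwa [add_sub_cancel_right] at this
    · have hay : a * y ∈ maximalIdeal A ^ 2 := by
        rw [pow_two]
        exact Ideal.mul_mem_mul ha (hl y (by simp))
      obtain ⟨l', h1, h2⟩ := ih z (fun u hu => hl u (by simp [hu])) hz
        fun h => hx2 (add_mem hay h)
      refine ⟨y :: l', by simp [← h1], ?_⟩
      rw [Ideal.ofList_cons y l, ← h2]
      simp only [Ideal.ofList_cons]
      apply le_antisymm
      · refine sup_le ((Ideal.span_singleton_le_iff_mem _).2 ?_) ?_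
        · exact add_mem (Submodule.mem_sup_left hw) (Submodule.mem_sup_right (Submodule.mem_sup_left
            (Ideal.mem_span_singleton_self z)))
        · exact sup_le_sup_left le_sup_right _
      · refine sup_le (le_sup_of_le_right le_sup_left) (sup_le ?_
          (le_sup_of_le_right le_sup_right))
        refine (Ideal.span_singleton_le_iff_mem _).2 ?_
        have := sub_mem (Submodule.mem_sup_left (T := Ideal.span {y} ⊔ Ideal.ofList l')
          (Ideal.mem_span_singleton_self (a * y + z)))
          (Submodule.mem_sup_right (Submodule.mem_sup_left hw))
        rwa [add_sub_cancel_left] at this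

theorem isLocalRing_quotient_span_singleton {A : Type*} [CommRing A] [IsLocalRing A] {x : A}
    (hx : x ∈ maximalIdeal A) : IsLocalRing (A ⧸ Ideal.span {x}) := by
  have : Nontrivial (A ⧸ Ideal.span {x}) := Ideal.Quotient.nontrivial_iff.2
    (ne_top_of_le_ne_top (maximalIdeal.isMaximal A).ne_top
      ((Ideal.span_singleton_le_iff_mem _).2 hx))
  exact IsLocalRing.of_surjective' _ Ideal.Quotient.mk_surjective

theorem natCast_le_ringKrullDim_quotient {A : Type*} [CommRing A] [IsLocalRing A]
    [IsNoetherianRing A] {n : ℕ} (hn : ((n + 1 : ℕ) : WithBot ℕ∞) ≤ ringKrullDim A)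
    {x : A} (hx : x ∈ maximalIdeal A) :
    (n : WithBot ℕ∞) ≤ ringKrullDim (A ⧸ Ideal.span {x}) := by
  have h := ringKrullDim_le_ringKrullDim_quotSMulTop_succ hx
  rw [← Submodule.ideal_span_singleton_smul, smul_eq_mul, Ideal.mul_top] at h
  have h2 := hn.trans h
  rw [Nat.cast_add, Nat.cast_one] at h2
  exact (ENat.WithBot.add_le_add_one_right_iff).1 h2

theorem ofList_map_mk_eq_maximalIdeal {A : Type*} [CommRing A] [IsLocalRing A] {x : A}
    {l : List A} [IsLocalRing (A ⧸ Ideal.span {x})] (h : Ideal.ofList (x :: l) = maximalIdeal A) :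
    Ideal.ofList (l.map (Ideal.Quotient.mk (Ideal.span {x}))) =
      maximalIdeal (A ⧸ Ideal.span {x}) := by
  have hs : Function.Surjective (Ideal.Quotient.mk (Ideal.span {x})) := Ideal.Quotient.mk_surjective
  have : IsLocalHom (Ideal.Quotient.mk (Ideal.span {x})) := IsLocalHom.of_surjective _ hs
  rw [← IsLocalRing.map_maximalIdeal_of_surjective _ hs, ← h, Ideal.ofList_cons, Ideal.map_sup,
    ← Ideal.map_ofList, Ideal.map_quotient_self, bot_sup_eq]

/-- A regular local ring is a domain. By induction on the dimension: for a suitable `x ∈ 𝔪 \ 𝔪²` the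
quotient `A / (x)` is a domain, and a minimal prime `P` contained in the prime ideal `(x)` with
`x ∉ P` satisfies `P = x P`, so that `P = 0`. -/
theorem isDomain_of_length_le_ringKrullDim {A : Type*} [CommRing A] [IsLocalRing A]
    [IsNoetherianRing A] (l : List A) (hl : Ideal.ofList l = maximalIdeal A)
    (hd : (l.length : WithBot ℕ∞) ≤ ringKrullDim A) : IsDomain A := by
  obtain ⟨n, hn⟩ : ∃ n, l.length = n := ⟨_, rfl⟩
  induction n generalizing A with
  | zero =>
    rw [List.length_eq_zero_iff] at hn
    subst hn
    rw [Ideal.ofList_nil] at hl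
    exact (IsLocalRing.isField_iff_maximalIdeal_eq.2 hl.symm).isDomain
  | succ n ih =>
    have hpos : ¬ (maximalIdeal A) ∈ minimalPrimes A := by
      intro h
      have h1 : (maximalIdeal A).height = 0 := Ideal.height_eq_zero_iff.2 h
      rw [← IsLocalRing.maximalIdeal_height_eq_ringKrullDim, h1, hn] at hd
      have : ((n + 1 : ℕ) : WithBot ℕ∞) ≤ ((0 : ℕ) : WithBot ℕ∞) := hd
      have := Nat.cast_le.1 this
      omega
    -- prime avoidance for `𝔪²` and the minimal primes
    have hex : ∃ x ∈ maximalIdeal A, x ∉ maximalIdeal A ^ 2 ∧ ∀ P ∈ minimalPrimes A, x ∉ P := by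
      by_contra! hcon
      have hfin : (insert (maximalIdeal A ^ 2) (minimalPrimes A)).Finite :=
        (minimalPrimes.finite_of_isNoetherianRing A).insert _
      have hsub : ((maximalIdeal A : Ideal A) : Set A) ⊆
          ⋃ i ∈ insert (maximalIdeal A ^ 2) (minimalPrimes A), (id i : Ideal A) := by
        intro x hx
        simp only [Set.mem_iUnion]
        by_cases h : x ∈ maximalIdeal A ^ 2
        · exact ⟨_, Or.inl rfl, h⟩
        · obtain ⟨P, hP, hxP⟩ := hcon x hx h
          exact ⟨P, Or.inr hP, hxP⟩
      rw [Ideal.subset_union_prime_finite (f := id) hfin (maximalIdeal A ^ 2) (maximalIdeal A ^ 2)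
        (fun i hi h _ => (hi.resolve_left h).1.1)] at hsub
      obtain ⟨P, rfl | hP, hle⟩ := hsub
      · have hbot : maximalIdeal A = ⊥ := by
          refine Submodule.eq_bot_of_le_smul_of_le_jacobson_bot (maximalIdeal A) _
            (IsNoetherian.noetherian _) ?_ (IsLocalRing.maximalIdeal_le_jacobson _)
          rw [smul_eq_mul, ← pow_two]
          exact hle
        have := (IsLocalRing.isField_iff_maximalIdeal_eq.2 hbot).isDomain
        apply hpos
        rw [hbot, IsDomain.minimalPrimes_eq_singleton_bot]
        rfl
      · have hPp : P.IsPrime := hP.1.1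
        have : maximalIdeal A = P := le_antisymm hle (IsLocalRing.le_maximalIdeal hPp.ne_top)
        exact hpos (this ▸ hP)
    obtain ⟨x, hxm, hx2, hxP⟩ := hex
    obtain ⟨l', hlen, hl'⟩ := exists_ofList_cons_eq l x
      (fun y hy => hl ▸ Ideal.subset_span hy) (hl ▸ hxm) hx2
    rw [hl] at hl'
    have := isLocalRing_quotient_span_singleton hxm
    have hdom : IsDomain (A ⧸ Ideal.span {x}) := by
      refine ih (l'.map (Ideal.Quotient.mk _)) (ofList_map_mk_eq_maximalIdeal hl') ?_
        (by simp; omega)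
      rw [List.length_map]
      refine natCast_le_ringKrullDim_quotient ?_ hxm
      rwa [hlen]
    have hprime : (Ideal.span {x}).IsPrime := (Ideal.Quotient.isDomain_iff_prime _).1 hdom
    obtain ⟨P, hP, hPx⟩ := Ideal.exists_minimalPrimes_le (bot_le : ⊥ ≤ Ideal.span {x})
    have hPp : P.IsPrime := hP.1.1
    have hPbot : P = ⊥ := by
      refine Submodule.eq_bot_of_le_smul_of_le_jacobson_bot (Ideal.span {x}) _
        (IsNoetherian.noetherian _) ?_ ?_
      · intro y hy
        obtain ⟨a, rfl⟩ := Ideal.mem_span_singleton'.1 (hPx hy)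
        have ha : a ∈ P := (hPp.mem_or_mem hy).resolve_right (hxP P hP)
        rw [smul_eq_mul, mul_comm a]
        exact Ideal.mul_mem_mul (Ideal.mem_span_singleton_self x) ha
      · exact ((Ideal.span_singleton_le_iff_mem _).2 hxm).trans
          (IsLocalRing.maximalIdeal_le_jacobson _)
    rw [hPbot] at hPp
    exact IsDomain.of_bot_isPrime A

/-- A regular system of parameters is a regular sequence. -/
theorem isWeaklyRegular_of_length_le_ringKrullDim {A : Type*} [CommRing A] [IsLocalRing A]
    [IsNoetherianRing A] (l : List A) (hl : Ideal.ofList l = maximalIdeal A)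
    (hd : (l.length : WithBot ℕ∞) ≤ ringKrullDim A) : IsWeaklyRegular A l := by
  obtain ⟨n, hn⟩ : ∃ n, l.length = n := ⟨_, rfl⟩
  induction n generalizing A with
  | zero =>
    rw [List.length_eq_zero_iff] at hn
    subst hn
    exact IsWeaklyRegular.nil _ _
  | succ n ih =>
    obtain ⟨x, l', rfl⟩ := List.exists_cons_of_length_eq_add_one hn
    have := isDomain_of_length_le_ringKrullDim _ hl hd
    have hxm : x ∈ maximalIdeal A := hl ▸ Ideal.subset_span (by simp)
    -- otherwise `𝔪` would be generated by fewer than `dim A` elements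
    have hx0 : x ≠ 0 := by
      rintro rfl
      classical
      have h1 : Ideal.span ((l'.toFinset : Finset A) : Set A) = maximalIdeal A := by
        rw [← hl, Ideal.ofList_cons, Ideal.span_singleton_eq_bot.2 rfl, bot_sup_eq]
        exact congrArg Ideal.span (by ext; simp)
      have h2 := hd.trans (ringKrullDim_le_spanFinrank_maximalIdeal A)
      rw [hn] at h2
      have h3 : n + 1 ≤ (maximalIdeal A).spanFinrank := by exact_mod_cast h2
      have h4 := Submodule.spanFinrank_span_le_ncard_of_finite (R := A) (l'.toFinset).finite_toSet
      rw [Set.ncard_coe_finset] at h4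
      have h5 := l'.toFinset_card_le
      have h6 : l'.length = n := by simpa using hn
      have h7 : (maximalIdeal A).spanFinrank ≤ l'.toFinset.card := h1 ▸ h4
      omega
    have := isLocalRing_quotient_span_singleton hxm
    rw [isWeaklyRegular_cons_iff]
    refine ⟨IsSMulRegular.of_ne_zero hx0, ?_⟩
    have h := ih (l'.map (Ideal.Quotient.mk _)) (ofList_map_mk_eq_maximalIdeal hl)
      (by
        rw [List.length_map]
        exact natCast_le_ringKrullDim_quotient hd hxm) (by simpa using hn)
    have h' := (isWeaklyRegular_map_algebraMap_iff (A ⧸ Ideal.span {x}) _ l').1 h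
    refine (LinearEquiv.isWeaklyRegular_congr (Submodule.quotEquivOfEq _ _ ?_) l').1 h'
    rw [← Submodule.ideal_span_singleton_smul, smul_eq_mul, Ideal.mul_top]

/-- Powers of a regular sequence form a regular sequence: over a local ring regular sequences can be
permuted, and the last element of a regular sequence can be replaced by its powers. -/
theorem isWeaklyRegular_map_pow {A M : Type*} [CommRing A] [IsLocalRing A] [AddCommGroup M]
    [Module A M] [IsNoetherian A M] (n : ℕ) (l : List A) (hl : ∀ x ∈ l, x ∈ maximalIdeal A)
    (hn : n ≠ 0) (h : IsWeaklyRegular M l) : IsWeaklyRegular M (l.map (· ^ n)) := by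
  induction l generalizing M with
  | nil => exact h
  | cons x l ih =>
    have h1 : IsWeaklyRegular M (l ++ [x]) :=
      IsLocalRing.isWeaklyRegular_of_perm_of_subset_maximalIdeal h
        (List.perm_append_singleton x l).symm hl
    have h2 : IsWeaklyRegular M (l ++ [x ^ n]) := by
      rw [isWeaklyRegular_append_iff, isWeaklyRegular_singleton_iff] at h1 ⊢
      exact ⟨h1.1, h1.2.pow n⟩
    have h3 : IsWeaklyRegular M (x ^ n :: l) :=
      IsLocalRing.isWeaklyRegular_of_perm_of_subset_maximalIdeal h2
        (List.perm_append_singleton _ l) (by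
          intro y hy
          rcases List.mem_append.1 hy with hy | hy
          · exact hl y (by simp [hy])
          · rw [List.mem_singleton.1 hy]
            exact Ideal.pow_mem_of_mem _ (hl x (by simp)) n (Nat.pos_of_ne_zero hn))
    rw [isWeaklyRegular_cons_iff] at h3
    rw [List.map_cons, isWeaklyRegular_cons_iff]
    exact ⟨h3.1, ih (fun y hy => hl y (by simp [hy])) h3.2⟩

/-- A finite module over a local ring is free if some generators of the maximal ideal form a regular
sequence on it. -/
theorem free_of_isWeaklyRegular {A M : Type*} [CommRing A] [IsLocalRing A] [IsNoetherianRing A]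
    [AddCommGroup M] [Module A M] [Module.Finite A M] (l : List A)
    (hl : Ideal.ofList l = maximalIdeal A) (h : IsWeaklyRegular M l) : Module.Free A M := by
  obtain ⟨n, hn⟩ : ∃ n, l.length = n := ⟨_, rfl⟩
  induction n generalizing A M with
  | zero =>
    rw [List.length_eq_zero_iff] at hn
    subst hn
    rw [Ideal.ofList_nil] at hl
    let := (IsLocalRing.isField_iff_maximalIdeal_eq.2 hl.symm).toField
    exact Module.Free.of_divisionRing A M
  | succ n ih =>
    obtain ⟨x, l', rfl⟩ := List.exists_cons_of_length_eq_add_one hn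
    have hxm : x ∈ maximalIdeal A := hl ▸ Ideal.subset_span (by simp)
    have := isLocalRing_quotient_span_singleton hxm
    rw [isWeaklyRegular_cons_iff'] at h
    have : Module.Finite (A ⧸ Ideal.span {x}) (QuotSMulTop x M) :=
      Module.Finite.of_restrictScalars_finite A _ _
    have : Module.FinitePresentation A M := Module.finitePresentation_of_finite A M
    rw [← Module.free_quotSMulTop_iff_free A M (IsLocalRing.maximalIdeal_le_jacobson _ hxm) h.1]
    exact ih (l'.map (Ideal.Quotient.mk _)) (ofList_map_mk_eq_maximalIdeal hl) h.2
      (by simpa using hn)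

end RegularLocal

/-! ### Kunz's theorem -/

section Kunz

open IsLocalRing RingTheory.Sequence

/-- The ring `A`, regarded as an algebra over `A`, and over any `S` with an algebra structure
`S → A`, through the `e`-th iterate of the Frobenius of `A`. A type synonym keeps this structure
apart from the algebra structure of `A` over itself. -/
def FrobeniusAlgebra (_p _e : ℕ) (A : Type*) : Type _ := A

section

variable (p e : ℕ) (A : Type*) [CommRing A]

instance : CommRing (FrobeniusAlgebra p e A) := inferInstanceAs (CommRing A)

instance [IsNoetherianRing A] : IsNoetherianRing (FrobeniusAlgebra p e A) :=
  inferInstanceAs (IsNoetherianRing A)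

instance (S : Type*) [CommRing S] [Algebra S A] [ExpChar A p] :
    Algebra S (FrobeniusAlgebra p e A) :=
  ((iterateFrobenius A p e).comp (algebraMap S A)).toAlgebra

variable {p e A}

/-- The identity map, from `A` to its Frobenius algebra. -/
def toFrobeniusAlgebra : A ≃+* FrobeniusAlgebra p e A := RingEquiv.refl A

variable {S : Type*} [CommRing S] [Algebra S A] [ExpChar A p]

theorem smul_toFrobeniusAlgebra (s : S) (x : A) :
    s • (toFrobeniusAlgebra x : FrobeniusAlgebra p e A) =
      toFrobeniusAlgebra (algebraMap S A s ^ p ^ e * x) := rfl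

instance (T : Type*) [CommRing T] [Algebra T A] [Algebra S T] [IsScalarTower S T A] :
    IsScalarTower S T (FrobeniusAlgebra p e A) :=
  IsScalarTower.of_algebraMap_eq fun s => by
    change (algebraMap S A s) ^ p ^ e = (algebraMap T A (algebraMap S T s)) ^ p ^ e
    rw [← IsScalarTower.algebraMap_apply]

end

/-- Kunz's theorem for regular local rings: the `p^e`-th powers of a regular system of parameters
form a regular sequence. -/
theorem free_frobeniusAlgebra (p e : ℕ) (A : Type*) [CommRing A] [IsRegularLocalRing A]
    [ExpChar A p] [Module.Finite A (FrobeniusAlgebra p e A)] :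
    Module.Free A (FrobeniusAlgebra p e A) := by
  obtain ⟨s, hs, hspan⟩ := Submodule.FG.exists_span_finset_card_eq_spanFinrank
    (IsNoetherian.noetherian (maximalIdeal A))
  have hl : Ideal.ofList s.toList = maximalIdeal A := by
    rw [← hspan]
    exact congrArg Ideal.span (by ext; simp)
  have hreg : IsWeaklyRegular A s.toList := by
    refine isWeaklyRegular_of_length_le_ringKrullDim _ hl ?_
    rw [Finset.length_toList, hs, IsRegularLocalRing.spanFinrank_maximalIdeal]
  have hpow := isWeaklyRegular_map_pow (p ^ e) s.toList
    (fun x hx => hl ▸ Ideal.subset_span hx) (expChar_pow_pos A p e).ne' hreg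
  refine free_of_isWeaklyRegular s.toList hl ?_
  rw [← isWeaklyRegular_map_algebraMap_iff (FrobeniusAlgebra p e A)]
  exact hpow

/-- Frobenius algebras are compatible with localization. -/
theorem isLocalizedModule_frobeniusAlgebra (p e : ℕ) {R : Type*} [CommRing R] [ExpChar R p]
    (S : Submonoid R) (A : Type*) [CommRing A] [Algebra R A] [IsLocalization S A] [ExpChar A p]
    (φ : FrobeniusAlgebra p e R →ₗ[R] FrobeniusAlgebra p e A)
    (hφ : ∀ x : R, φ (toFrobeniusAlgebra x) = toFrobeniusAlgebra (algebraMap R A x)) :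
    IsLocalizedModule S φ := by
  have hq : p ^ e ≠ 0 := (expChar_pow_pos R p e).ne'
  refine ⟨?_, ?_, ?_⟩
  · intro s
    rw [Module.End.isUnit_iff]
    have hu : IsUnit ((algebraMap R A s) ^ p ^ e) := (IsLocalization.map_units A s).pow _
    exact IsUnit.isUnit_iff_mulLeft_bijective.1 hu
  · intro y
    obtain ⟨⟨a, s⟩, h⟩ := IsLocalization.surj S (toFrobeniusAlgebra.symm y)
    -- `a / s = s^{p^e - 1} a / s^{p^e}`, and `s` acts as multiplication by `s^{p^e}`
    refine ⟨(toFrobeniusAlgebra ((s : R) ^ (p ^ e - 1) * a), s), ?_⟩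
    rw [hφ]
    refine congrArg (toFrobeniusAlgebra (p := p) (e := e) (A := A)) ?_
    change algebraMap R A s ^ p ^ e * toFrobeniusAlgebra.symm y = _
    rw [map_mul, ← h, map_pow, mul_left_comm, mul_comm, pow_sub_one_mul hq]
  · intro x y hxy
    have hxy' : algebraMap R A (toFrobeniusAlgebra.symm x) =
        algebraMap R A (toFrobeniusAlgebra.symm y) := by
      apply (toFrobeniusAlgebra (p := p) (e := e)).injective
      rw [← hφ, ← hφ]
      simpa using hxy
    obtain ⟨s, hs⟩ := (IsLocalization.eq_iff_exists S A).1 hxy'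
    refine ⟨s, ?_⟩
    refine congrArg (toFrobeniusAlgebra (p := p) (e := e) (A := R)) ?_
    change (s : R) ^ p ^ e * toFrobeniusAlgebra.symm x = (s : R) ^ p ^ e * toFrobeniusAlgebra.symm y
    rw [← pow_sub_one_mul hq, mul_assoc, hs, mul_assoc]

/-- Kunz's theorem: an `F`-finite regular ring is a finite projective module over itself via
Frobenius. -/
theorem projective_frobeniusAlgebra (p e : ℕ) {R : Type*} [CommRing R] [IsRegularRing R]
    [Fact p.Prime] [CharP R p] [Module.Finite R (FrobeniusAlgebra p e R)] :
    Module.Projective R (FrobeniusAlgebra p e R) := by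
  have : Module.FinitePresentation R (FrobeniusAlgebra p e R) :=
    Module.finitePresentation_of_finite R _
  refine Module.projective_of_localization_maximal fun P hP => ?_
  have : CharP (Localization.AtPrime P) p := by
    refine (CharP.charP_iff_prime_eq_zero Fact.out).2 ?_
    rw [← map_natCast (algebraMap R _), CharP.cast_eq_zero, map_zero]
  let φ : FrobeniusAlgebra p e R →ₗ[R] FrobeniusAlgebra p e (Localization.AtPrime P) :=
    { toFun := fun x => toFrobeniusAlgebra (algebraMap R _ (toFrobeniusAlgebra.symm x))
      map_add' := fun x y => by simp only [map_add]
      map_smul' := fun r x => by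
        obtain ⟨x, rfl⟩ := toFrobeniusAlgebra.surjective x
        rw [smul_toFrobeniusAlgebra, RingEquiv.symm_apply_apply, RingEquiv.symm_apply_apply,
          map_mul, map_pow, RingHom.id_apply, smul_toFrobeniusAlgebra]
        rfl }
  have : IsLocalizedModule P.primeCompl φ :=
    isLocalizedModule_frobeniusAlgebra p e P.primeCompl _ φ fun x => rfl
  have : Module.Finite (Localization.AtPrime P) (FrobeniusAlgebra p e (Localization.AtPrime P)) :=
    Module.Finite.of_isLocalizedModule P.primeCompl φ
  have := free_frobeniusAlgebra p e (Localization.AtPrime P)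
  exact Module.Projective.of_equiv (LinearEquiv.extendScalarsOfIsLocalization P.primeCompl
    (Localization.AtPrime P) (IsLocalizedModule.linearEquiv P.primeCompl φ
      (LocalizedModule.mkLinearMap P.primeCompl (FrobeniusAlgebra p e R))))

theorem finite_frobeniusAlgebra (p e : ℕ) {R : Type*} [CommRing R] [ExpChar R p]
    (hF : (frobenius R p).Finite) : Module.Finite R (FrobeniusAlgebra p e R) := by
  have h : (iterateFrobenius R p e).Finite := by
    induction e with
    | zero => rw [iterateFrobenius_zero]; exact RingHom.Finite.id R
    | succ e ih =>
      have : iterateFrobenius R p (e + 1) = (frobenius R p).comp (iterateFrobenius R p e) := by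
        ext x
        simp [iterateFrobenius_def, frobenius_def, pow_succ, pow_mul]
      rw [this]
      exact hF.comp ih
  exact h

/-- A dual basis exhibiting `R` as a finite projective module over itself via the `e`-th iterate of
Frobenius: `p^{-e}`-linear maps `coord i : R → R` and elements `gen i` such that every `y` is
`∑ i, coord i y ^ p ^ e * gen i`. -/
structure FrobeniusDualBasis (R : Type*) [CommRing R] (p e : ℕ) where
  /-- the number of generators -/
  card : ℕ
  /-- the generators -/
  gen : Fin card → R
  /-- the `p^{-e}`-linear coordinates -/
  coord : Fin card → R →+ R
  coord_pow_mul : ∀ i a y, coord i (a ^ p ^ e * y) = a * coord i y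
  sum_coord : ∀ y, ∑ i, coord i y ^ p ^ e * gen i = y

theorem nonempty_frobeniusDualBasis (p e : ℕ) {R : Type*} [CommRing R] [IsRegularRing R]
    [Fact p.Prime] [CharP R p] (hF : (frobenius R p).Finite) :
    Nonempty (FrobeniusDualBasis R p e) := by
  have := finite_frobeniusAlgebra p e hF
  have := projective_frobeniusAlgebra p e (R := R)
  obtain ⟨n, f, g, -, -, hfg⟩ :=
    Module.Finite.exists_comp_eq_id_of_projective R (FrobeniusAlgebra p e R)
  refine ⟨⟨n, fun i => toFrobeniusAlgebra.symm (f (Pi.single i 1)), fun i =>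
    ((LinearMap.proj i ∘ₗ g).toAddMonoidHom.comp
      (toFrobeniusAlgebra (p := p) (e := e)).toAddMonoidHom), fun i a y =>
        congrFun (g.map_smul a (toFrobeniusAlgebra y)) i, fun y => ?_⟩⟩
  have h : f (g (toFrobeniusAlgebra y)) = toFrobeniusAlgebra y := LinearMap.congr_fun hfg _
  have h2 := congrArg (toFrobeniusAlgebra (p := p) (e := e)).symm h
  rw [RingEquiv.symm_apply_apply, LinearMap.pi_apply_eq_sum_univ f, map_sum] at h2
  refine Eq.trans (Finset.sum_congr rfl fun i _ => ?_) h2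
  have h3 : (fun j => if i = j then (1 : R) else 0) = Pi.single i 1 := by
    ext j
    rw [Pi.single_apply]
    simp only [eq_comm]
  rw [h3]
  rfl

end Kunz

/-! ### Frobenius powers, Frobenius roots and test ideals -/

section FrobeniusPower

variable {R : Type*} [CommRing R] {p e : ℕ}

theorem pow_mem_frobeniusPower {J : Ideal R} {u : R} (hu : u ∈ J) :
    u ^ p ^ e ∈ frobeniusPower p e J := Ideal.subset_span ⟨u, hu, rfl⟩

theorem frobeniusPower_mono {I J : Ideal R} (h : I ≤ J) :
    frobeniusPower p e I ≤ frobeniusPower p e J :=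
  Ideal.span_mono (Set.image_mono h)

theorem frobeniusPower_le_pow (J : Ideal R) : frobeniusPower p e J ≤ J ^ p ^ e := by
  refine Ideal.span_le.2 ?_
  rintro _ ⟨u, hu, rfl⟩
  exact Ideal.pow_mem_pow hu _

namespace FrobeniusDualBasis

theorem mem_frobeniusPower_iff (b : FrobeniusDualBasis R p e) {J : Ideal R} {y : R} :
    y ∈ frobeniusPower p e J ↔ ∀ i, b.coord i y ∈ J := by
  constructor
  · intro hy i
    have : ∀ r, b.coord i (r * y) ∈ J := by
      refine Submodule.span_induction (p := fun y _ => ∀ r, b.coord i (r * y) ∈ J) ?_ ?_ ?_ ?_ hy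
      · rintro _ ⟨u, hu, rfl⟩ r
        simp only
        rw [mul_comm, b.coord_pow_mul]
        exact Ideal.mul_mem_right _ _ hu
      · simp
      · intro u v _ _ hu hv r
        rw [mul_add, map_add]
        exact add_mem (hu r) (hv r)
      · intro a u _ hu r
        rw [smul_eq_mul, ← mul_assoc]
        exact hu _
    simpa using this 1
  · intro h
    rw [← b.sum_coord y]
    exact sum_mem fun i _ => Ideal.mul_mem_right _ _ (pow_mem_frobeniusPower (h i))

/-- The root `(g)^{[1/p^e]}` is generated by the coordinates of `g`. -/
theorem frobeniusRoot_span_singleton (b : FrobeniusDualBasis R p e) (g : R) :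
    frobeniusRoot p e (Ideal.span {g}) = Ideal.span (Set.range fun i => b.coord i g) := by
  refine le_antisymm (sInf_le ?_) (le_sInf fun J hJ => ?_)
  · exact (Ideal.span_singleton_le_iff_mem _).2
      (b.mem_frobeniusPower_iff.2 fun i => Ideal.subset_span ⟨i, rfl⟩)
  · rw [Ideal.span_le]
    rintro _ ⟨i, rfl⟩
    exact b.mem_frobeniusPower_iff.1 ((Ideal.span_singleton_le_iff_mem _).1 hJ) i

theorem frobeniusRoot_le_iff (b : FrobeniusDualBasis R p e) {g : R} {J : Ideal R} :
    frobeniusRoot p e (Ideal.span {g}) ≤ J ↔ g ∈ frobeniusPower p e J := by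
  rw [b.frobeniusRoot_span_singleton, Ideal.span_le, b.mem_frobeniusPower_iff]
  exact Set.range_subset_iff

theorem mem_frobeniusPower_frobeniusRoot (b : FrobeniusDualBasis R p e) (g : R) :
    g ∈ frobeniusPower p e (frobeniusRoot p e (Ideal.span {g})) :=
  b.frobeniusRoot_le_iff.1 le_rfl

/-- `I^{[p^e]} : u^{p^e}` is contained in `(I : u)^{[p^e]}`. -/
theorem mem_frobeniusPower_colon (b : FrobeniusDualBasis R p e) {I : Ideal R} {u g : R}
    (h : u ^ p ^ e * g ∈ frobeniusPower p e I) :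
    g ∈ frobeniusPower p e (Submodule.comap (LinearMap.mulLeft R u) I) := by
  rw [b.mem_frobeniusPower_iff] at h ⊢
  intro i
  rw [Submodule.mem_comap, LinearMap.mulLeft_apply, ← b.coord_pow_mul]
  exact h i

theorem frobeniusRoot_span_antitone (b : FrobeniusDualBasis R p e) {g h : R} (hgh : g ∣ h) :
    frobeniusRoot p e (Ideal.span {h}) ≤ frobeniusRoot p e (Ideal.span {g}) := by
  rw [b.frobeniusRoot_le_iff]
  exact Ideal.mem_of_dvd _ hgh (b.mem_frobeniusPower_frobeniusRoot g)

end FrobeniusDualBasis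

variable [ExpChar R p]

theorem frobeniusPower_le_self (J : Ideal R) : frobeniusPower p e J ≤ J :=
  (frobeniusPower_le_pow J).trans (Ideal.pow_le_self (expChar_pow_pos R p e).ne')

theorem frobeniusPower_span (S : Set R) :
    frobeniusPower p e (Ideal.span S) = Ideal.span ((fun u => u ^ p ^ e) '' S) := by
  refine le_antisymm (Ideal.span_le.2 ?_) (Ideal.span_mono (Set.image_mono Ideal.subset_span))
  rintro _ ⟨u, hu, rfl⟩
  refine Submodule.span_induction (p := fun u _ => u ^ p ^ e ∈
    Ideal.span ((fun u => u ^ p ^ e) '' S)) ?_ ?_ ?_ ?_ hu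
  · exact fun u hu => Ideal.subset_span ⟨u, hu, rfl⟩
  · rw [zero_pow (expChar_pow_pos R p e).ne']
    exact zero_mem _
  · intro u v _ _ hu hv
    rw [add_pow_expChar_pow]
    exact add_mem hu hv
  · intro a u _ hu
    rw [smul_eq_mul, mul_pow]
    exact Ideal.mul_mem_left _ _ hu

theorem frobeniusPower_add (e k : ℕ) (J : Ideal R) :
    frobeniusPower p (e + k) J = frobeniusPower p k (frobeniusPower p e J) := by
  rw [frobeniusPower.eq_1 p e, frobeniusPower_span, frobeniusPower, Set.image_image]
  simp only [pow_add, pow_mul]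

namespace FrobeniusDualBasis

/-- Faithful flatness of Frobenius, in terms of ideals. -/
theorem pow_mem_frobeniusPower_iff (b : FrobeniusDualBasis R p e) {I : Ideal R} {u : R} :
    u ^ p ^ e ∈ frobeniusPower p e I ↔ u ∈ I := by
  refine ⟨fun h => ?_, pow_mem_frobeniusPower⟩
  have := frobeniusPower_le_self _ (b.mem_frobeniusPower_colon (g := 1) (by rwa [mul_one]))
  simpa using this

/-- The `D_R^e`-submodule of `R` generated by `g` is the Frobenius power of the Frobenius root
of `(g)`. -/
theorem exists_diffOp_apply_eq_iff (b : FrobeniusDualBasis R p e) {g y : R} :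
    (∃ P : DiffOp R p e, P g = y) ↔
      y ∈ frobeniusPower p e (frobeniusRoot p e (Ideal.span {g})) := by
  constructor
  · rintro ⟨P, rfl⟩
    rw [← b.sum_coord g, map_sum]
    refine sum_mem fun i _ => ?_
    rw [DiffOp.map_pow_mul, b.sum_coord, b.frobeniusRoot_span_singleton]
    exact Ideal.mul_mem_right _ _ (pow_mem_frobeniusPower (Ideal.subset_span ⟨i, rfl⟩))
  · rw [b.frobeniusRoot_span_singleton, frobeniusPower_span]
    intro hy
    induction hy using Submodule.span_induction with
    | mem y hy =>
      obtain ⟨_, ⟨i, rfl⟩, rfl⟩ := hy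
      -- the operator `y ↦ (coord i y)^{p^e}`
      exact ⟨DiffOp.mk' p e ((iterateFrobenius R p e).toAddMonoidHom.comp (b.coord i))
        fun a x => by
          simp only [AddMonoidHom.comp_apply, b.coord_pow_mul]
          exact mul_pow _ _ _, rfl⟩
    | zero => exact ⟨0, rfl⟩
    | add u v _ _ hu hv =>
      obtain ⟨P, rfl⟩ := hu
      obtain ⟨Q, rfl⟩ := hv
      exact ⟨P + Q, rfl⟩
    | smul a u _ hu =>
      obtain ⟨P, rfl⟩ := hu
      exact ⟨mulOp p e a * P, rfl⟩

end FrobeniusDualBasis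

end FrobeniusPower

section TestIdeals

variable {R : Type*} [CommRing R] {p : ℕ} (f : R)

theorem testIdeal_antitone (b : ∀ e : ℕ, FrobeniusDualBasis R p e) :
    Antitone (testIdeal p f) := by
  intro lam mu h
  refine iSup_mono fun e => (b e).frobeniusRoot_span_antitone (pow_dvd_pow f ?_)
  gcongr

variable [ExpChar R p]

theorem frobeniusRoot_span_pow_mul (b : ∀ e : ℕ, FrobeniusDualBasis R p e) (e k r : ℕ) :
    frobeniusRoot p (e + k) (Ideal.span {f ^ (r * p ^ k)}) =
      frobeniusRoot p e (Ideal.span {f ^ r}) := by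
  have key : ∀ J : Ideal R, frobeniusRoot p (e + k) (Ideal.span {f ^ (r * p ^ k)}) ≤ J ↔
      frobeniusRoot p e (Ideal.span {f ^ r}) ≤ J := fun J => by
    rw [(b _).frobeniusRoot_le_iff, (b _).frobeniusRoot_le_iff, frobeniusPower_add, pow_mul,
      (b k).pow_mem_frobeniusPower_iff]
  exact le_antisymm ((key _).2 le_rfl) ((key _).1 le_rfl)

theorem frobeniusRoot_span_pow_le (b : ∀ e : ℕ, FrobeniusDualBasis R p e) {e e' r r' : ℕ}
    (h : r * p ^ e' ≤ r' * p ^ e) :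
    frobeniusRoot p e' (Ideal.span {f ^ r'}) ≤ frobeniusRoot p e (Ideal.span {f ^ r}) := by
  rw [← frobeniusRoot_span_pow_mul f b e' e, ← frobeniusRoot_span_pow_mul f b e e', add_comm e']
  exact (b _).frobeniusRoot_span_antitone (pow_dvd_pow f h)

/-- At a rational number `r / p^e` the chain that defines the test ideal is constant from `e` on. -/
theorem testIdeal_div (b : ∀ e : ℕ, FrobeniusDualBasis R p e) (e r : ℕ) :
    testIdeal p f ((r : ℝ) / (p : ℝ) ^ e) = frobeniusRoot p e (Ideal.span {f ^ r}) := by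
  have hp : (0 : ℝ) < p := by exact_mod_cast expChar_pos R p
  refine le_antisymm (iSup_le fun e' => frobeniusRoot_span_pow_le f b ?_) ?_
  · have h := Nat.le_ceil ((r : ℝ) / (p : ℝ) ^ e * (p : ℝ) ^ e')
    conv_lhs at h => rw [div_mul_eq_mul_div]
    rw [div_le_iff₀ (by positivity)] at h
    exact_mod_cast h
  · refine le_iSup_of_le e (le_of_eq ?_)
    rw [div_mul_cancel₀ _ (by positivity), Nat.ceil_natCast]

variable [IsNoetherianRing R] {f}

/-- The ascending chain of ideals that defines a test ideal is stationary. -/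
theorem exists_testIdeal_eq_frobeniusRoot (b : ∀ e : ℕ, FrobeniusDualBasis R p e) (lam : ℝ) :
    ∃ e, testIdeal p f lam = frobeniusRoot p e (Ideal.span {f ^ ⌈lam * (p : ℝ) ^ e⌉₊}) := by
  let J : ℕ →o Ideal R := ⟨fun e => frobeniusRoot p e (Ideal.span {f ^ ⌈lam * (p : ℝ) ^ e⌉₊}),
    monotone_nat_of_le_succ fun e => frobeniusRoot_span_pow_le f b (by
      rw [pow_succ p e, mul_comm (p ^ e), ← mul_assoc]
      gcongr
      rw [Nat.ceil_le]
      push_cast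
      rw [pow_succ, ← mul_assoc]
      gcongr
      exact Nat.le_ceil _)⟩
  obtain ⟨K, hK⟩ := monotone_stabilizes_iff_noetherian.2 ‹IsNoetherian R R› J
  refine ⟨K, le_antisymm (iSup_le fun k => ?_) (le_iSup (f := J) K)⟩
  change J k ≤ J K
  rcases le_total K k with h | h
  · exact (hK k h).ge
  · exact J.mono h

variable [IsDomain R]

/-- Right-continuity of the test ideals at `N / p^e`. If `J` is the limit of the ideals on the left
and `I = J^{[p^e]}`, then `f` lies in `(I : f^N)^{[p^k]}` for all `k`. As `f ≠ 0`, Krull's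
intersection theorem forces `I : f^N` to be the unit ideal, that is, `f^N ∈ I`. -/
theorem exists_frobeniusRoot_eq (b : ∀ e : ℕ, FrobeniusDualBasis R p e) (hf : f ≠ 0)
    (hp1 : 1 < p) (e N : ℕ) :
    ∃ k, frobeniusRoot p (e + k) (Ideal.span {f ^ (N * p ^ k + 1)}) =
      frobeniusRoot p e (Ideal.span {f ^ N}) := by
  let J : ℕ →o Ideal R := ⟨fun k => frobeniusRoot p (e + k) (Ideal.span {f ^ (N * p ^ k + 1)}),
    monotone_nat_of_le_succ fun k => frobeniusRoot_span_pow_le f b (by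
      have h1 : 0 < p ^ (e + k) := by positivity
      calc (N * p ^ (k + 1) + 1) * p ^ (e + k) ≤ ((N * p ^ k + 1) * p) * p ^ (e + k) := by
            gcongr
            rw [pow_succ]
            nlinarith
        _ = (N * p ^ k + 1) * p ^ (e + (k + 1)) := by ring)⟩
  obtain ⟨K, hK⟩ := monotone_stabilizes_iff_noetherian.2 ‹IsNoetherian R R› J
  have hJ : ∀ k, J k ≤ J K := fun k => by
    rcases le_total K k with h | h
    · exact (hK k h).ge
    · exact J.mono h
  refine ⟨K, le_antisymm (frobeniusRoot_span_pow_le f b ?_) ((b e).frobeniusRoot_le_iff.2 ?_)⟩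
  · rw [pow_add]
    nlinarith [Nat.zero_le (p ^ e)]
  · change f ^ N ∈ frobeniusPower p e (J K)
    set I := frobeniusPower p e (J K) with hI
    have h1 : ∀ k, f ∈ frobeniusPower p k (Submodule.comap (LinearMap.mulLeft R (f ^ N)) I) := by
      intro k
      apply (b k).mem_frobeniusPower_colon
      rw [hI, ← frobeniusPower_add, ← pow_mul, ← pow_succ]
      exact frobeniusPower_mono (hJ k) ((b _).mem_frobeniusPower_frobeniusRoot _)
    have htop : Submodule.comap (LinearMap.mulLeft R (f ^ N)) I = (⊤ : Ideal R) := by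
      by_contra hne
      have h2 := Ideal.iInf_pow_eq_bot_of_isDomain
        (Submodule.comap (LinearMap.mulLeft R (f ^ N)) I : Ideal R) hne
      apply hf
      rw [← Ideal.mem_bot, ← h2, Ideal.mem_iInf]
      exact fun k => Ideal.pow_le_pow_right (Nat.lt_pow_self hp1).le
        (frobeniusPower_le_pow _ (h1 k))
    have h3 : (1 : R) ∈ Submodule.comap (LinearMap.mulLeft R (f ^ N)) I := htop ▸ Submodule.mem_top
    simpa using h3

/-- Test ideals are right-continuous in the exponent. -/
theorem exists_pos_testIdeal_add_eq (b : ∀ e : ℕ, FrobeniusDualBasis R p e) (hf : f ≠ 0)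
    (hp1 : 1 < p) (lam : ℝ) :
    ∃ ε > 0, ∀ mu, lam ≤ mu → mu ≤ lam + ε → testIdeal p f mu = testIdeal p f lam := by
  have hp : (0 : ℝ) < p := by exact_mod_cast expChar_pos R p
  obtain ⟨e, he⟩ := exists_testIdeal_eq_frobeniusRoot b (f := f) lam
  set N := ⌈lam * (p : ℝ) ^ e⌉₊ with hN
  obtain ⟨k, hk⟩ := exists_frobeniusRoot_eq b hf hp1 e N
  refine ⟨1 / (p : ℝ) ^ (e + k), by positivity, fun mu h1 h2 =>
    le_antisymm (testIdeal_antitone f b h1) ?_⟩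
  rw [he, ← hk, ← testIdeal_div f b]
  refine testIdeal_antitone f b (h2.trans ?_)
  rw [le_div_iff₀ (by positivity), add_mul, div_mul_cancel₀ _ (by positivity), pow_add,
    ← mul_assoc]
  push_cast
  gcongr
  exact Nat.le_ceil _

/-- The interval `(j / p^e, (j + 1) / p^e]` contains an `F`-jumping exponent if and only if the
Frobenius roots of `f^j` and `f^(j+1)` differ. -/
theorem exists_isFJumpingExponent_iff (b : ∀ e : ℕ, FrobeniusDualBasis R p e) (hf : f ≠ 0)
    (hp1 : 1 < p) (e j : ℕ) :
    (∃ lam : ℝ, (j : ℝ) / (p : ℝ) ^ e < lam ∧ lam ≤ ((j + 1 : ℕ) : ℝ) / (p : ℝ) ^ e ∧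
      IsFJumpingExponent p f lam) ↔
    frobeniusRoot p e (Ideal.span {f ^ j}) ≠ frobeniusRoot p e (Ideal.span {f ^ (j + 1)}) := by
  have hp : (0 : ℝ) < p := by exact_mod_cast expChar_pos R p
  have hanti := testIdeal_antitone f b
  rw [← testIdeal_div f b, ← testIdeal_div f b]
  set α := (j : ℝ) / (p : ℝ) ^ e with hα
  set β := ((j + 1 : ℕ) : ℝ) / (p : ℝ) ^ e with hβ
  have hα0 : 0 ≤ α := by positivity
  have hαβ : α ≤ β := by
    rw [hα, hβ]
    gcongr
    omega
  constructor
  · rintro ⟨lam, h1, h2, hj⟩ heq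
    rcases hj with rfl | ⟨h3, h4⟩
    · exact absurd h1 hα0.not_gt
    · refine h4 (lam - α) (by linarith) (by linarith) ?_
      rw [sub_sub_cancel]
      exact le_antisymm (hanti h1.le) (heq.le.trans (hanti h2))
  · intro hne
    -- the least exponent in the interval where the test ideal differs from `τ(f^α)` is a jump
    let S : Set ℝ := {x | α ≤ x ∧ x ≤ β ∧ testIdeal p f x ≠ testIdeal p f α}
    have hS : S.Nonempty := ⟨β, hαβ, le_rfl, hne.symm⟩
    have hbdd : BddBelow S := ⟨α, fun x hx => hx.1⟩
    have hα' : α ≤ sInf S := le_csInf hS fun x hx => hx.1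
    have hβ' : sInf S ≤ β := csInf_le hbdd ⟨hαβ, le_rfl, hne.symm⟩
    have hmem : testIdeal p f (sInf S) ≠ testIdeal p f α := by
      intro heq
      obtain ⟨ε, hε, h⟩ := exists_pos_testIdeal_add_eq b hf hp1 (sInf S)
      obtain ⟨x, hx, hxlt⟩ := exists_lt_of_csInf_lt hS (lt_add_of_pos_right (sInf S) hε)
      exact hx.2.2 ((h x (csInf_le hbdd hx) hxlt.le).trans heq)
    have hlt : α < sInf S := lt_of_le_of_ne hα' fun h => hmem (by rw [← h])
    refine ⟨sInf S, hlt, hβ', Or.inr ⟨hα0.trans_lt hlt, fun ε hε _ heq => ?_⟩⟩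
    rcases le_total α (sInf S - ε) with h | h
    · have hnot : sInf S - ε ∉ S := notMem_of_lt_csInf (by linarith) hbdd
      apply hmem
      by_contra hcon
      exact hnot ⟨h, by linarith, heq ▸ hcon⟩
    · exact hmem (le_antisymm (hanti hα') ((hanti h).trans heq.ge))

end TestIdeals

/-! ### Base-`p` digits -/

section Digits

/-- If `n + j = p^e - 1`, then the base-`p` digits of `n` and `j` add up to `p - 1`. -/
theorem dvd_div_add_digit {p e n j : ℕ} (hp : 1 < p) (h : n + j + 1 = p ^ e) (l : ℕ) (hl : l < e) :
    p ∣ n / p ^ l + 1 + j / p ^ l % p := by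
  have hP : 0 < p ^ l := by positivity
  obtain ⟨d, rfl⟩ := Nat.exists_eq_add_of_lt hl
  have h1 := Nat.div_add_mod n (p ^ l)
  have h2 := Nat.div_add_mod j (p ^ l)
  have h3 := Nat.mod_lt n hP
  have h4 := Nat.mod_lt j hP
  have h5 : p ^ (l + d + 1) = p ^ l * (p * p ^ d) := by ring
  set P := p ^ l
  have h6 : P * (n / P + j / P) + (n % P + j % P + 1) = P * (p * p ^ d) := by
    rw [← h5, ← h, mul_add]; omega
  have h7 : n % P + j % P + 1 = P := by
    have hd : P ∣ n % P + j % P + 1 :=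
      (Nat.dvd_add_right (dvd_mul_right P _)).1 (h6 ▸ dvd_mul_right P _)
    obtain ⟨c, hc⟩ := hd
    have : c = 1 := by
      have h8 : P * c < P * 2 := by omega
      have h9 := Nat.lt_of_mul_lt_mul_left h8
      have : c ≠ 0 := by rintro rfl; omega
      omega
    rw [hc, this, mul_one]
  have h8 : n / P + j / P + 1 = p * p ^ d := by
    apply Nat.eq_of_mul_eq_mul_left hP
    rw [← h6, h7]; ring
  have h9 : p ∣ n / P + j / P + 1 := h8 ▸ dvd_mul_right _ _
  have h10 := Nat.div_add_mod (j / P) p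
  have h11 : n / P + j / P + 1 = p * (j / P / p) + (n / P + 1 + j / P % p) := by omega
  rw [h11] at h9
  exact (Nat.dvd_add_right (dvd_mul_right p _)).1 h9

/-- For `m < p^e`, the eigenvalues `m / p^l + 1` of the `θ_{p^l}` on `t^m` are modulo `p` the
negatives of the digits of `j` if and only if `m = p^e - 1 - j`. -/
theorem forall_dvd_digit_iff {p e : ℕ} (hp : 1 < p) (i : Fin e → Fin p) {m : ℕ}
    (hm : m < p ^ e) :
    (∀ l : Fin e, p ∣ m / p ^ (l : ℕ) + 1 + i l) ↔
      m + (finFunctionFinEquiv i : ℕ) + 1 = p ^ e := by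
  have hi : ∀ l, (i l : ℕ) = (finFunctionFinEquiv i : ℕ) / p ^ (l : ℕ) % p := fun l => by
    conv_lhs => rw [← finFunctionFinEquiv.symm_apply_apply i]
    rfl
  constructor
  · intro h
    have hlt := (finFunctionFinEquiv i).2
    have hn : p ^ e - 1 - (finFunctionFinEquiv i : ℕ) < p ^ e := by omega
    have heq : (⟨m, hm⟩ : Fin (p ^ e)) = ⟨_, hn⟩ := by
      apply finFunctionFinEquiv.symm.injective
      ext l
      change m / p ^ (l : ℕ) % p = (p ^ e - 1 - (finFunctionFinEquiv i : ℕ)) / p ^ (l : ℕ) % p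
      have h1 := h l
      have h2 := dvd_div_add_digit (n := p ^ e - 1 - (finFunctionFinEquiv i : ℕ))
        (j := finFunctionFinEquiv i) hp (by omega) l l.2
      rw [← hi] at h2
      rw [add_assoc] at h1 h2
      exact Nat.ModEq.add_right_cancel' (1 + (i l : ℕ))
        (((Nat.modEq_zero_iff_dvd).2 h1).trans ((Nat.modEq_zero_iff_dvd).2 h2).symm)
    have := congrArg Fin.val heq
    simp only at this
    omega
  · intro h l
    rw [hi]
    exact dvd_div_add_digit hp h l l.2

end Digits

/-! ### Fractions with denominator `(f - t)^{p^e}` in `B_f` -/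

section Fractions

variable {R : Type*} [CommRing R] (p : ℕ) [Fact p.Prime] [CharP R p] (e : ℕ) (f : R)

/-- The additive map that sends `h` to the class of `h / (f - t)^{p^e}` in `B_f`. -/
noncomputable def frac : R[X] →+ B f :=
  (Submodule.mkQ (LinearMap.range (Algebra.linearMap R[X]
      (Localization.Away (C f - X : R[X]))))).toAddMonoidHom.comp
    ((AddMonoidHom.mulRight (IsLocalization.Away.invSelf (C f - X : R[X]) ^ p ^ e)).comp
      (algebraMap R[X] (Localization.Away (C f - X : R[X]))).toAddMonoidHom)

theorem algebraMap_mul_invSelf_pow {A : Type*} [CommRing A] (g : A) (n : ℕ) :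
    algebraMap A (Localization.Away g) (g ^ n) * IsLocalization.Away.invSelf g ^ n = 1 := by
  rw [map_pow, ← mul_pow, IsLocalization.Away.mul_invSelf, one_pow]

theorem smul_frac (P : DiffOp R[X] p e) (h : R[X]) : P • frac p e f h = frac p e f (P h) := by
  set g : R[X] := C f - X with hg
  have hu := algebraMap_mul_invSelf_pow g (p ^ e)
  have hact : ∀ y : Localization.Away g, powElt p e g • y =
      algebraMap R[X] (Localization.Away g) (g ^ p ^ e) * y := fun y => by
    rw [Algebra.smul_def]; rfl
  have key : locAction p e g P (algebraMap R[X] (Localization.Away g) h *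
      IsLocalization.Away.invSelf g ^ p ^ e) =
      algebraMap R[X] (Localization.Away g) (P h) * IsLocalization.Away.invSelf g ^ p ^ e := by
    have h1 : powElt p e g • (algebraMap R[X] (Localization.Away g) h *
        IsLocalization.Away.invSelf g ^ p ^ e) = algebraMap R[X] (Localization.Away g) h := by
      rw [hact, mul_left_comm, hu, mul_one]
    have h2 := congrArg (locAction p e g P) h1
    rw [map_smul, locAction_algebraMap, hact] at h2
    rw [← h2, mul_right_comm, hu, one_mul]
  exact congrArg Submodule.Quotient.mk key

theorem X_smul_frac (h : R[X]) : (X : R[X]) • frac p e f h = frac p e f (X * h) := by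
  rw [← mulOp_smul p e, smul_frac, mulOp_apply]

theorem delta_eq_frac : delta f = frac p e f ((C f - X) ^ (p ^ e - 1)) := by
  set g : R[X] := C f - X with hg
  have hq : p ^ e ≠ 0 := (expChar_pow_pos R p e).ne'
  have : (IsLocalization.Away.invSelf g : Localization.Away g) =
      algebraMap R[X] (Localization.Away g) (g ^ (p ^ e - 1)) *
        IsLocalization.Away.invSelf g ^ p ^ e := by
    rw [← pow_sub_one_mul hq (IsLocalization.Away.invSelf g), ← mul_assoc,
      algebraMap_mul_invSelf_pow, one_mul]
  exact congrArg Submodule.Quotient.mk this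

theorem coeff_geomSum_X_C (n q : ℕ) :
    (∑ i ∈ Finset.range q, (X : R[X]) ^ i * (C f) ^ (q - 1 - i)).coeff n =
      if n < q then f ^ (q - 1 - n) else 0 := by
  simp only [finsetSum_coeff, ← C_pow, coeff_X_pow_mul', coeff_C]
  split_ifs with h
  · rw [Finset.sum_eq_single n]
    · simp
    · intro i _ hi
      split_ifs <;> first | omega | rfl
    · simp [h]
  · refine Finset.sum_eq_zero fun i hi => ?_
    have := Finset.mem_range.1 hi
    split_ifs <;> first | omega | rfl

variable [IsDomain R]

theorem frac_eq_zero_iff {h : R[X]} : frac p e f h = 0 ↔ (X ^ p ^ e - C (f ^ p ^ e)) ∣ h := by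
  have hpow : (C f - X : R[X]) ^ p ^ e = -(X ^ p ^ e - C (f ^ p ^ e)) := by
    rw [sub_pow_expChar_pow, C_pow, neg_sub]
  rw [← neg_dvd, ← hpow]
  set g : R[X] := C f - X with hg
  have hg0 : g ≠ 0 := by
    intro h0
    have := congrArg (coeff · 1) h0
    simp [hg, coeff_X] at this
  have hu := algebraMap_mul_invSelf_pow g (p ^ e)
  have hinj : Function.Injective (algebraMap R[X] (Localization.Away g)) :=
    IsLocalization.injective _ (powers_le_nonZeroDivisors_of_noZeroDivisors hg0)
  have h0 : frac p e f h = 0 ↔ algebraMap R[X] (Localization.Away g) h *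
      IsLocalization.Away.invSelf g ^ p ^ e ∈
        LinearMap.range (Algebra.linearMap R[X] (Localization.Away g)) :=
    Submodule.Quotient.mk_eq_zero _
  rw [h0]
  constructor
  · rintro ⟨c, hc⟩
    refine ⟨c, hinj ?_⟩
    rw [map_mul]
    change algebraMap R[X] (Localization.Away g) c = _ at hc
    rw [hc, mul_left_comm, hu, mul_one]
  · rintro ⟨c, rfl⟩
    refine ⟨c, ?_⟩
    change algebraMap R[X] (Localization.Away g) c = _
    rw [map_mul, mul_right_comm, hu, one_mul]

/-- `(f - t)^{p^e - 1}` is the quotient of `f^{p^e} - t^{p^e}` by `f - t`, a geometric sum. -/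
theorem coeff_C_sub_X_pow (n : ℕ) :
    ((C f - X : R[X]) ^ (p ^ e - 1)).coeff n = if n < p ^ e then f ^ (p ^ e - 1 - n) else 0 := by
  have hq : p ^ e ≠ 0 := (expChar_pow_pos R p e).ne'
  rw [← coeff_geomSum_X_C]
  congr 1
  apply mul_right_cancel₀ (b := X - C f) (X_sub_C_ne_zero f)
  rw [geom_sum₂_mul, ← neg_sub (C f) X, mul_neg, pow_sub_one_mul hq, sub_pow_expChar_pow, neg_sub]

end Fractions

/-! ### The ring `D_R^e[θ_1, θ_p, …]` -/

section EulerSubring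

variable {R : Type*} [CommRing R] (p : ℕ) [Fact p.Prime] [CharP R p] (e : ℕ)

/-- Elements of `D_R^e[θ_1, θ_p, …]` act on each coefficient by a differential operator. -/
theorem exists_coeff_eq (s : DiffOp R[X] p e) (hs : s ∈ eulerSubring R p e) (n : ℕ) :
    ∃ P : DiffOp R p e, ∀ h : R[X], (s h).coeff n = P (h.coeff n) := by
  induction hs using Subring.closure_induction with
  | mem s hs =>
    rcases hs with ⟨P, rfl⟩ | ⟨i, rfl⟩
    · exact ⟨P, fun h => constOp_coeff p e P h n⟩
    · exact ⟨mulOp p e _, fun h => theta_coeff p e i h n⟩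
  | zero => exact ⟨0, fun h => rfl⟩
  | one => exact ⟨1, fun h => rfl⟩
  | add a b _ _ ha hb =>
    obtain ⟨P, hP⟩ := ha
    obtain ⟨Q, hQ⟩ := hb
    exact ⟨P + Q, fun h => by rw [LinearMap.add_apply, coeff_add, hP, hQ, LinearMap.add_apply]⟩
  | neg a _ ha =>
    obtain ⟨P, hP⟩ := ha
    exact ⟨-P, fun h => by rw [LinearMap.neg_apply, coeff_neg, hP, LinearMap.neg_apply]⟩
  | mul a b _ _ ha hb =>
    obtain ⟨P, hP⟩ := ha
    obtain ⟨Q, hQ⟩ := hb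
    exact ⟨P * Q, fun h => by rw [Module.End.mul_apply, hP, hQ, Module.End.mul_apply]⟩

variable (R) in
/-- The operator `θ_{p^l} + c`. -/
noncomputable def shiftedTheta (l : Fin e) (c : ℕ) : eulerSubring R p e :=
  ⟨theta R p e l, theta_mem p e l⟩ + (c : eulerSubring R p e)

theorem shiftedTheta_coeff (l : Fin e) (c : ℕ) (h : R[X]) (n : ℕ) :
    ((shiftedTheta R p e l c : DiffOp R[X] p e) h).coeff n =
      ((n / p ^ (l : ℕ) + 1 + c : ℕ) : R) * h.coeff n := by
  have : (shiftedTheta R p e l c : DiffOp R[X] p e) = theta R p e l + (c : DiffOp R[X] p e) := rfl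
  rw [this, LinearMap.add_apply, coeff_add, theta_coeff, Module.End.natCast_apply, coeff_smul,
    nsmul_eq_mul]
  push_cast
  ring

theorem shiftedTheta_pow_coeff (l : Fin e) (c k : ℕ) (h : R[X]) (n : ℕ) :
    (((shiftedTheta R p e l c ^ k : eulerSubring R p e) : DiffOp R[X] p e) h).coeff n =
      ((n / p ^ (l : ℕ) + 1 + c : ℕ) : R) ^ k * h.coeff n := by
  induction k generalizing h with
  | zero => simp
  | succ k ih =>
    rw [pow_succ, Subring.coe_mul, Module.End.mul_apply, ih, shiftedTheta_coeff, pow_succ,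
      mul_assoc]

/-- The product of the operators `1 - (θ_{p^l} + c_l)^{p-1}` projects onto the simultaneous
eigenspace where each `θ_{p^l}` acts as `-c_l`, and it is congruent to `1` modulo the left ideal
generated by the `θ_{p^l} + c_l`. -/
theorem exists_eigenprojection (c : Fin e → ℕ) : ∃ E : eulerSubring R p e,
    (∀ (h : R[X]) (n : ℕ), ((E : DiffOp R[X] p e) h).coeff n =
        if ∀ l : Fin e, p ∣ n / p ^ (l : ℕ) + 1 + c l then h.coeff n else 0) ∧
    1 - E ∈ Ideal.span (Set.range fun l => shiftedTheta R p e l (c l)) := by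
  suffices H : ∀ s : Finset (Fin e), ∃ E : eulerSubring R p e,
      (∀ (h : R[X]) (n : ℕ), ((E : DiffOp R[X] p e) h).coeff n =
        if ∀ l ∈ s, p ∣ n / p ^ (l : ℕ) + 1 + c l then h.coeff n else 0) ∧
      1 - E ∈ Ideal.span (Set.range fun l => shiftedTheta R p e l (c l)) by
    obtain ⟨E, h1, h2⟩ := H Finset.univ
    exact ⟨E, fun h n => by simpa using h1 h n, h2⟩
  intro s
  induction s using Finset.induction_on with
  | empty => exact ⟨1, by simp, by simp⟩
  | insert l s _ ih =>
    obtain ⟨E, h1, h2⟩ := ih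
    refine ⟨E * (1 - shiftedTheta R p e l (c l) ^ (p - 1)), fun h n => ?_, ?_⟩
    · rw [Subring.coe_mul, Module.End.mul_apply, h1, AddSubgroupClass.coe_sub, Subring.coe_one,
        LinearMap.sub_apply, Module.End.one_apply, coeff_sub, shiftedTheta_pow_coeff,
        natCast_pow_sub_one]
      simp only [Finset.forall_mem_insert]
      by_cases h3 : p ∣ n / p ^ (l : ℕ) + 1 + c l <;> simp [h3]
    · have hp : p - 1 ≠ 0 := Nat.sub_ne_zero_of_lt (Fact.out : p.Prime).one_lt
      have : 1 - E * (1 - shiftedTheta R p e l (c l) ^ (p - 1)) =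
          (1 - E) + E * shiftedTheta R p e l (c l) ^ (p - 1) := by
        rw [mul_sub, mul_one]; abel
      rw [this, ← pow_sub_one_mul hp, ← mul_assoc]
      exact add_mem h2 (Ideal.mul_mem_left _ _ (Ideal.subset_span ⟨l, rfl⟩))

end EulerSubring

/-! ### The quotient `M_f^e / t M_f^e` and the set `Γ_f^e` -/

section Gamma

variable {R : Type*} [CommRing R] {p : ℕ} [Fact p.Prime] [CharP R p] {e : ℕ} {f : R}

/-- `M_f^e` consists of the fractions `s ((f - t)^{p^e - 1}) / (f - t)^{p^e}`. -/
theorem mem_M_iff {u : B f} : u ∈ M p e f ↔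
    ∃ s : eulerSubring R p e,
      u = frac p e f ((s : DiffOp R[X] p e) ((C f - X) ^ (p ^ e - 1))) := by
  rw [M, Submodule.mem_span_singleton]
  refine exists_congr fun s => ?_
  have : s • delta f = frac p e f ((s : DiffOp R[X] p e) ((C f - X) ^ (p ^ e - 1))) := by
    rw [delta_eq_frac p e f, ← smul_frac]
    rfl
  rw [this, eq_comm]

/-- A projector on `R[t]` that extracts, from polynomials of degree below `p^e`, the term of degree
`p^e - 1 - j`, where `j` is the number with base-`p` digits `i`. -/
theorem exists_monomialProjection (i : Fin e → Fin p) {n : ℕ}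
    (hn : n + (finFunctionFinEquiv i : ℕ) + 1 = p ^ e) : ∃ E : eulerSubring R p e,
    (∀ h : R[X], (∀ m, p ^ e ≤ m → h.coeff m = 0) →
      (E : DiffOp R[X] p e) h = monomial n (h.coeff n)) ∧
    1 - E ∈ Ideal.span (Set.range fun l => shiftedTheta R p e l (i l)) := by
  obtain ⟨E, h1, h2⟩ := exists_eigenprojection (R := R) p e fun l => (i l : ℕ)
  refine ⟨E, fun h hh => ?_, h2⟩
  ext m
  rw [h1, coeff_monomial]
  by_cases hm : m < p ^ e
  · simp only [forall_dvd_digit_iff (Fact.out : p.Prime).one_lt i hm]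
    by_cases hmn : n = m
    · subst hmn
      rw [if_pos hn, if_pos rfl]
    · rw [if_neg (by omega), if_neg hmn]
  · rw [hh m (by omega), ite_self, if_neg (by omega)]

theorem sum_digit_div_eq (i : Fin e → Fin p) :
    (∑ l : Fin e, ((i l : ℕ) : ℚ) / (p : ℚ) ^ (e - (l : ℕ))) =
      ((finFunctionFinEquiv i : ℕ) : ℚ) / (p : ℚ) ^ e := by
  have hp : (p : ℚ) ≠ 0 := by exact_mod_cast (Fact.out : p.Prime).ne_zero
  rw [finFunctionFinEquiv_apply, Nat.cast_sum, Finset.sum_div]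
  refine Finset.sum_congr rfl fun l _ => ?_
  rw [pow_sub₀ _ hp l.2.le]
  push_cast
  field_simp

variable (p e f) in
/-- The tuple of the digits of `j` contributes the root `j / p^e`. -/
theorem roots_bernsteinSato : (bernsteinSato p e f).roots =
    (GammaSet p e f).val.map fun i => ((finFunctionFinEquiv i : ℕ) : ℚ) / (p : ℚ) ^ e := by
  rw [bernsteinSato]
  simp only [sum_digit_div_eq]
  refine Eq.trans ?_ (roots_multiset_prod_X_sub_C _)
  rw [Multiset.map_map]
  rfl

variable [IsDomain R]

/-- In degree `n = p^e - 1 - k`, the coefficients of `M_f^e` lie in `D_R^e f^k`. -/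
theorem coeff_apply_mem (b : FrobeniusDualBasis R p e) (s : eulerSubring R p e) {n k : ℕ}
    (hn : n + k + 1 = p ^ e) :
    ((s : DiffOp R[X] p e) ((C f - X) ^ (p ^ e - 1))).coeff n ∈
      frobeniusPower p e (frobeniusRoot p e (Ideal.span {f ^ k})) := by
  obtain ⟨P, hP⟩ := exists_coeff_eq (R := R) p e s s.2 n
  rw [hP, coeff_C_sub_X_pow, if_pos (by omega), show p ^ e - 1 - n = k by omega]
  exact b.exists_diffOp_apply_eq_iff.1 ⟨P, rfl⟩

theorem coeff_apply_eq_zero (s : eulerSubring R p e) {n : ℕ} (hn : p ^ e ≤ n) :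
    ((s : DiffOp R[X] p e) ((C f - X) ^ (p ^ e - 1))).coeff n = 0 := by
  obtain ⟨P, hP⟩ := exists_coeff_eq (R := R) p e s s.2 n
  rw [hP, coeff_C_sub_X_pow, if_neg (by omega), map_zero]

/-- In degree `n = p^e - 1 - k`, every element of `D_R^e f^k` is a coefficient of `M_f^e`. -/
theorem frac_monomial_mem_M (b : FrobeniusDualBasis R p e) {n k : ℕ} (hn : n + k + 1 = p ^ e)
    {a : R}
    (ha : a ∈ frobeniusPower p e (frobeniusRoot p e (Ideal.span {f ^ k}))) :
    frac p e f (monomial n a) ∈ M p e f := by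
  obtain ⟨P, rfl⟩ := b.exists_diffOp_apply_eq_iff.2 ha
  obtain ⟨E, hE, -⟩ := exists_monomialProjection (R := R) (p := p) (e := e)
    (finFunctionFinEquiv.symm ⟨k, by omega⟩) (n := n) (by rw [Equiv.apply_symm_apply]; exact hn)
  refine mem_M_iff.2 ⟨⟨constOp p e P, Subring.subset_closure (Or.inl ⟨P, rfl⟩)⟩ * E, ?_⟩
  rw [Subring.coe_mul, Module.End.mul_apply, hE _ fun m hm => by
    rw [coeff_C_sub_X_pow, if_neg hm.not_gt], coeff_C_sub_X_pow, if_pos (by omega),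
    show p ^ e - 1 - n = k by omega]
  congr 1
  ext m
  rw [constOp_coeff, coeff_monomial, coeff_monomial]
  split_ifs
  · rfl
  · rw [map_zero]

/-- In degree `n = p^e - 1 - j`, every element of `D_R^e f^{j+1}` is a coefficient of `t M_f^e`. For
`n = 0` this uses `t^{p^e} = f^{p^e}` modulo `(f - t)^{p^e}`. -/
theorem frac_monomial_mem_tM (b : FrobeniusDualBasis R p e) {n j : ℕ}
    (hn : n + j + 1 = p ^ e) {a : R}
    (ha : a ∈ frobeniusPower p e (frobeniusRoot p e (Ideal.span {f ^ (j + 1)}))) :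
    frac p e f (monomial n a) ∈ tM p e f := by
  rcases n with _ | n
  · have hj : j + 1 = p ^ e := by omega
    rw [hj] at ha
    obtain ⟨P, rfl⟩ := b.exists_diffOp_apply_eq_iff.2 ha
    refine ⟨frac p e f (monomial j (P 1)), frac_monomial_mem_M b (k := 0) (by omega)
      (b.exists_diffOp_apply_eq_iff.1 ⟨P, by rw [pow_zero]⟩), ?_⟩
    rw [X_smul_frac, ← sub_eq_zero, ← map_sub, frac_eq_zero_iff]
    refine ⟨-C (P 1), ?_⟩
    have h1 : P (f ^ p ^ e) = f ^ p ^ e * P 1 := by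
      rw [← DiffOp.map_pow_mul, mul_one]
    rw [X_mul_monomial, hj, h1, monomial_zero_left, C_mul, ← C_mul_X_pow_eq_monomial]
    ring
  · refine ⟨frac p e f (monomial n a), frac_monomial_mem_M b (by omega) ha, ?_⟩
    rw [X_smul_frac, X_mul_monomial]

/-- The converse of `frac_monomial_mem_tM`: in degree `n = p^e - 1 - j`, the coefficients of
`t M_f^e` lie in `D_R^e f^{j+1}`. -/
theorem mem_of_frac_monomial_mem_tM (b : FrobeniusDualBasis R p e) {n j : ℕ}
    (hn : n + j + 1 = p ^ e) {a : R} (h : frac p e f (monomial n a) ∈ tM p e f) :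
    a ∈ frobeniusPower p e (frobeniusRoot p e (Ideal.span {f ^ (j + 1)})) := by
  obtain ⟨u, hu, huX⟩ := h
  obtain ⟨s, rfl⟩ := mem_M_iff.1 hu
  set h := (s : DiffOp R[X] p e) ((C f - X) ^ (p ^ e - 1)) with hdef
  have hq : 0 < p ^ e := by omega
  have hd : (X ^ p ^ e - C (f ^ p ^ e) : R[X]) ∣ monomial n a - X * h := by
    rw [← frac_eq_zero_iff p e f, map_sub, huX, X_smul_frac, sub_self]
  -- subtracting a multiple of `t^{p^e} - f^{p^e}` from `t h` removes its term of degree `p^e`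
  have hzero :
      monomial n a - X * h + C (h.coeff (p ^ e - 1)) * (X ^ p ^ e - C (f ^ p ^ e)) = 0 := by
    refine eq_zero_of_dvd_of_degree_lt (dvd_add hd (dvd_mul_left _ _)) ?_
    rw [degree_X_pow_sub_C hq, degree_lt_iff_coeff_zero]
    intro m hm
    obtain ⟨m, rfl⟩ : ∃ k, m = k + 1 := ⟨m - 1, by omega⟩
    rw [coeff_add, coeff_sub, coeff_monomial, if_neg (by omega), coeff_X_mul, coeff_C_mul,
      coeff_sub, coeff_X_pow, coeff_C_succ, sub_zero]
    split_ifs with h1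
    · rw [show p ^ e - 1 = m by omega]; ring
    · rw [hdef, coeff_apply_eq_zero s (by omega)]; ring
  have hc := congrArg (coeff · n) hzero
  simp only [coeff_add, coeff_sub, coeff_monomial, if_true, coeff_C_mul, coeff_X_pow, coeff_C,
    coeff_zero] at hc
  rcases n with _ | n
  · have hj : j + 1 = p ^ e := by omega
    rw [coeff_X_mul_zero, if_neg (by omega), if_pos rfl] at hc
    have ha : a = f ^ (j + 1) * h.coeff (p ^ e - 1) := by
      rw [hj]; linear_combination hc
    rw [ha]
    exact Ideal.mul_mem_right _ _ (b.mem_frobeniusPower_frobeniusRoot _)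
  · rw [coeff_X_mul, if_neg (by omega), if_neg (by omega)] at hc
    have ha : a = h.coeff n := by linear_combination hc
    rw [ha]
    exact coeff_apply_mem b s (by omega)

/-- The tuple of the digits of `j` belongs to `Γ_f^e` if and only if the Frobenius roots of `f^j`
and `f^{j+1}` differ. -/
theorem mem_GammaSet_iff (b : FrobeniusDualBasis R p e) (i : Fin e → Fin p) :
    i ∈ GammaSet p e f ↔
      frobeniusRoot p e (Ideal.span {f ^ (finFunctionFinEquiv i : ℕ)}) ≠
        frobeniusRoot p e (Ideal.span {f ^ ((finFunctionFinEquiv i : ℕ) + 1)}) := by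
  have hlt := (finFunctionFinEquiv i).2
  obtain ⟨n, hn⟩ : ∃ n, n + (finFunctionFinEquiv i : ℕ) + 1 = p ^ e :=
    ⟨p ^ e - 1 - (finFunctionFinEquiv i : ℕ), by omega⟩
  set j : ℕ := (finFunctionFinEquiv i : ℕ) with hj
  classical
  rw [GammaSet, Finset.mem_filter, and_iff_right (Finset.mem_univ _)]
  constructor
  · rintro ⟨w, hw0, hw⟩ heq
    obtain ⟨⟨u, hu⟩, rfl⟩ := Submodule.Quotient.mk_surjective _ w
    obtain ⟨s, rfl⟩ := mem_M_iff.1 hu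
    obtain ⟨E, hE, hfix⟩ := exists_monomialProjection (R := R) i hn
    have hE1 : E • (Submodule.Quotient.mk ⟨_, hu⟩ : MQuot p e f) =
        Submodule.Quotient.mk ⟨_, hu⟩ := by
      have h1 := (Ideal.span_le.2 (by
        rintro _ ⟨l, rfl⟩
        exact (Ideal.mem_torsionOf_iff _ _).2 (hw l)) :
          Ideal.span (Set.range fun l => shiftedTheta R p e l (i l)) ≤
            Ideal.torsionOf (eulerSubring R p e) (MQuot p e f)
              (Submodule.Quotient.mk ⟨_, hu⟩)) hfix
      rw [Ideal.mem_torsionOf_iff, sub_smul, one_smul, sub_eq_zero] at h1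
      exact h1.symm
    apply hw0
    rw [← hE1, ← Submodule.Quotient.mk_smul, Submodule.Quotient.mk_eq_zero]
    change (E : DiffOp R[X] p e) • frac p e f _ ∈ tM p e f
    rw [smul_frac, hE _ fun m hm => coeff_apply_eq_zero s hm]
    refine frac_monomial_mem_tM b hn ?_
    rw [← heq]
    exact coeff_apply_mem b s hn
  · intro hne
    refine ⟨Submodule.Quotient.mk ⟨frac p e f (monomial n (f ^ j)), frac_monomial_mem_M b hn
      (b.mem_frobeniusPower_frobeniusRoot _)⟩, fun h0 => hne ?_, fun l => ?_⟩
    · replace h0 : frac p e f (monomial n (f ^ j)) ∈ tM p e f :=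
        (Submodule.Quotient.mk_eq_zero ((tM p e f).submoduleOf (M p e f))).1 h0
      exact le_antisymm (b.frobeniusRoot_le_iff.2 (mem_of_frac_monomial_mem_tM b hn h0))
        (b.frobeniusRoot_span_antitone (pow_dvd_pow f (Nat.le_succ j)))
    · have h1 : (shiftedTheta R p e l (i l) : DiffOp R[X] p e) (monomial n (f ^ j)) = 0 := by
        ext m
        rw [shiftedTheta_coeff, coeff_monomial, coeff_zero]
        split_ifs with hm
        · subst hm
          rw [(CharP.cast_eq_zero_iff R p _).2 ((forall_dvd_digit_iff
            (Fact.out : p.Prime).one_lt i (by omega)).2 hn l), zero_mul]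
        · rw [mul_zero]
      change shiftedTheta R p e l (i l) • _ = _
      rw [← Submodule.Quotient.mk_smul, Submodule.Quotient.mk_eq_zero]
      change (shiftedTheta R p e l (i l) : DiffOp R[X] p e) • frac p e f _ ∈ tM p e f
      rw [smul_frac, h1, map_zero]
      exact zero_mem _

end Gamma

end BernsteinSato

theorem theorem6p3 {R : Type*} [CommRing R] [IsDomain R] [IsRegularRing R]
    (p : ℕ) [Fact p.Prime] [CharP R p] (hF : (frobenius R p).Finite)
    (f : R) (hf : f ≠ 0) (e : ℕ) (he : 1 ≤ e) :
    (∀ x : ℚ, (BernsteinSato.bernsteinSato p e f).IsRoot x →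
      (BernsteinSato.bernsteinSato p e f).rootMultiplicity x = 1) ∧
    ∀ x : ℚ, (BernsteinSato.bernsteinSato p e f).IsRoot x ↔
      ∃ lam : ℝ, 0 < lam ∧ lam ≤ 1 ∧ BernsteinSato.IsFJumpingExponent p f lam ∧
        x = ((⌈(p : ℝ) ^ e * lam⌉ : ℤ) - 1 : ℚ) / (p : ℚ) ^ e := by
  have b : ∀ e, BernsteinSato.FrobeniusDualBasis R p e := fun e =>
    (BernsteinSato.nonempty_frobeniusDualBasis p e hF).some
  have hp := (Fact.out : p.Prime)
  have hq : (0 : ℚ) < (p : ℚ) ^ e := by have := hp.pos; positivity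
  have hqR : (0 : ℝ) < (p : ℝ) ^ e := by have := hp.pos; positivity
  have hroots := BernsteinSato.roots_bernsteinSato p e f
  have hne : BernsteinSato.bernsteinSato p e f ≠ 0 :=
    Finset.prod_ne_zero_iff.2 fun i _ => X_sub_C_ne_zero _
  have hinj : Function.Injective fun i : Fin e → Fin p =>
      ((finFunctionFinEquiv i : ℕ) : ℚ) / (p : ℚ) ^ e := by
    intro i i' h
    have h' := (div_left_inj' hq.ne').1 h
    exact finFunctionFinEquiv.injective (Fin.ext (by exact_mod_cast h'))
  have hnodup : (BernsteinSato.bernsteinSato p e f).roots.Nodup := by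
    rw [hroots]
    exact (BernsteinSato.GammaSet p e f).nodup.map hinj
  refine ⟨fun x hx => ?_, fun x => ?_⟩
  · rw [← count_roots]
    exact Multiset.count_eq_one_of_mem hnodup ((mem_roots hne).2 hx)
  · rw [← mem_roots hne, hroots, Multiset.mem_map]
    constructor
    · rintro ⟨i, hi, rfl⟩
      have hi' := (BernsteinSato.mem_GammaSet_iff (b e) i).1 hi
      obtain ⟨lam, h1, h2, h3⟩ :=
        (BernsteinSato.exists_isFJumpingExponent_iff b hf hp.one_lt e _).2 hi'
      have hlt : (finFunctionFinEquiv i : ℕ) + 1 ≤ p ^ e := (finFunctionFinEquiv i).2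
      refine ⟨lam, lt_of_le_of_lt (by positivity) h1, h2.trans ?_, h3, ?_⟩
      · rw [div_le_one hqR]
        exact_mod_cast hlt
      · rw [div_lt_iff₀ hqR, mul_comm] at h1
        rw [le_div_iff₀ hqR, mul_comm] at h2
        have : ⌈(p : ℝ) ^ e * lam⌉ = (finFunctionFinEquiv i : ℕ) + 1 := by
          rw [Int.ceil_eq_iff]
          push_cast at h2 ⊢
          exact ⟨by linarith, h2⟩
        rw [this]
        push_cast
        ring
    · rintro ⟨lam, h0, h1, h2, rfl⟩
      have hpos : 0 < ⌈(p : ℝ) ^ e * lam⌉ := Int.ceil_pos.2 (by positivity)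
      obtain ⟨j, hj⟩ : ∃ j : ℕ, ⌈(p : ℝ) ^ e * lam⌉ = j + 1 :=
        ⟨(⌈(p : ℝ) ^ e * lam⌉ - 1).toNat, by omega⟩
      have hj' := Int.ceil_eq_iff.1 hj
      push_cast at hj'
      have hlt : j < p ^ e := by
        have h3 : (p : ℝ) ^ e * lam ≤ (p : ℝ) ^ e := by nlinarith
        have h4 : (j : ℝ) < (p : ℝ) ^ e := by linarith
        exact_mod_cast h4
      refine ⟨finFunctionFinEquiv.symm ⟨j, hlt⟩, (BernsteinSato.mem_GammaSet_iff (b e) _).2 ?_, ?_⟩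
      · rw [Equiv.apply_symm_apply]
        refine (BernsteinSato.exists_isFJumpingExponent_iff b hf hp.one_lt e j).1 ⟨lam, ?_, ?_, h2⟩
        · rw [div_lt_iff₀ hqR, mul_comm]
          linarith
        · rw [le_div_iff₀ hqR, mul_comm]
          push_cast
          exact hj'.2
      · rw [Equiv.apply_symm_apply, hj]
        push_cast
        ring
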